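/- Let $H$ be a separable real Hilbert space, let $(S(t))_{t\ge 0}$ be a $C_0$-semigroup on $H$, and let $Q$ be a bounded, selfadjoint, nonnegative operator on $H$. Put $Q_t=\int_0^t S(s)QS^*(s)\,ds$ for $0\le t\le\infty$, and assume that $$\int_0^\infty \mathrm{tr}\bigl(S(s)QS^*(s)\bigr)\,ds<\infty$$ and that $Q_\infty$ is injective. Let $\mu=N(0,Q_\infty)$ be the centered Gaussian measure on $H$ with covariance operator $Q_\infty$, and let $$R_t\phi(x)=\int_H \phi(S(t)x+y)\,N(0,Q_t)(dy),\qquad t\ge 0,\ x\in H,$$ for bounded Borel $\phi:H\to\mathbb R$, be the transition semigroup of the Ornstein-Uhlenbeck process $dZ=AZ\,dt+\sqrt Q\,dW$, where $A$ is the generator of $(S(t))$. Assume that $(R_t)$ is symmetric, that is, $$\int_H\psi\,R_t\phi\,d\mu=\int_H\phi\,R_t\psi\,d\mu$$ for all $t\ge 0$ and all bounded Borel functions $\phi,\psi$. Then each $R_t$ extends from bounded Borel functions to a bounded operator (still denoted by $R_t$) on $L^2(H,\mu)$, the operator $Q^{1/2}$ is injective, $S(t)Q^{1/2}(H)\subset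 Q^{1/2}(H)$ for all $t\ge0$, and the operators $S_Q(t)=Q^{-1/2}S(t)Q^{1/2}$, $t\ge 0$, form a $C_0$-semigroup of bounded operators on $H$. Moreover, $R_t$ is compact in $L^2(H,\mu)$ for every $t>0$ if and only if $(S_Q(t))$ is compact (that is, $S_Q(t)$ is a compact operator on $H$ for every $t>0$) and exponentially stable (that is, $\|S_Q(t)\|\le Me^{-\omega t}$ for all $t\ge 0$, with some constants $M$ and $\omega>0$). -/

import Mathlib

open MeasureTheory Set
open scoped NNReal ENNReal InnerProductSpace

noncomputable section

namespace OrnsteinUhlenbeck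

/-- A strongly continuous semigroup of bounded operators on a Banach space. -/
structure IsC0Semigroup {E : Type*} [NormedAddCommGroup E] [NormedSpace ℝ E]
    (S : ℝ≥0 → E →L[ℝ] E) : Prop where
  map_zero : S 0 = ContinuousLinearMap.id ℝ E
  map_add : ∀ s t, S (s + t) = S s ∘L S t
  continuous_orbit : ∀ x, Continuous fun t => S t x

/-- Compactness of a semigroup: `T t` is a compact operator for every `t > 0`. -/
def IsCompactSemigroup {E : Type*} [NormedAddCommGroup E] [NormedSpace ℝ E]
    (T : ℝ≥0 → E →L[ℝ] E) : Prop :=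
  ∀ t, 0 < t → IsCompactOperator (T t)

/-- Exponential stability: `‖T t‖ ≤ M * exp (-ω t)` for some `M` and some `ω > 0`. -/
def IsExponentiallyStable {E : Type*} [NormedAddCommGroup E] [NormedSpace ℝ E]
    (T : ℝ≥0 → E →L[ℝ] E) : Prop :=
  ∃ M ω : ℝ, 0 < ω ∧ ∀ t : ℝ≥0, ‖T t‖ ≤ M * Real.exp (-ω * t)

/-- The trace, in `[0, ∞]`, of a nonnegative operator: the sum of `⟪T e, e⟫` over the elements `e`
of an orthonormal basis (for nonnegative `T` the sum does not depend on the basis). -/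
def posTrace {H : Type*} [NormedAddCommGroup H] [InnerProductSpace ℝ H] [CompleteSpace H]
    (T : H →L[ℝ] H) : ℝ≥0∞ :=
  ∑' i, ENNReal.ofReal
    ⟪T ((exists_hilbertBasis ℝ H).choose_spec.choose i),
      (exists_hilbertBasis ℝ H).choose_spec.choose i⟫_ℝ

/-- The nonnegative square root of a nonnegative selfadjoint operator, i.e. the unique
nonnegative selfadjoint operator whose square is `Q`. -/
def posSqrt {H : Type*} [NormedAddCommGroup H] [InnerProductSpace ℝ H] [CompleteSpace H]
    (Q : H →L[ℝ] H) : H →L[ℝ] H :=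
  Classical.epsilon fun B => B.IsPositive ∧ B ∘L B = Q

/-- `μ` is the centered Gaussian probability measure with covariance operator `C`. A measure on
a separable Hilbert space is determined by its characteristic functional. -/
def IsCenteredGaussian {H : Type*} [NormedAddCommGroup H] [InnerProductSpace ℝ H]
    [MeasurableSpace H] (C : H → H) (μ : Measure H) : Prop :=
  IsProbabilityMeasure μ ∧ ∀ h, charFun μ h = Complex.exp (-(⟪C h, h⟫_ℝ : ℂ) / 2)

/-- `N(0, C)`: the centered Gaussian measure with covariance operator `C`; it exists, and is
unique, whenever `C` is nonnegative, selfadjoint and of trace class. -/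
def centeredGaussian {H : Type*} [NormedAddCommGroup H] [InnerProductSpace ℝ H]
    [MeasurableSpace H] (C : H → H) : Measure H :=
  Classical.epsilon (IsCenteredGaussian C)

/-- The operator `x ↦ ∫_I S(s) Q S*(s) x ds` for a set `I` of positive times. With `I = (0, t]`
this is `Q_t`, with `I = (0, ∞)` it is `Q_∞`. -/
def covOp {H : Type*} [NormedAddCommGroup H] [InnerProductSpace ℝ H] [CompleteSpace H]
    (S : ℝ≥0 → H →L[ℝ] H) (Q : H →L[ℝ] H) (I : Set ℝ) (x : H) : H :=
  ∫ s in I, S s.toNNReal (Q ((S s.toNNReal).adjoint x))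

/-- The invariant measure `μ = N(0, Q_∞)`. -/
def invariantMeasure {H : Type*} [NormedAddCommGroup H] [InnerProductSpace ℝ H] [CompleteSpace H]
    [MeasurableSpace H] (S : ℝ≥0 → H →L[ℝ] H) (Q : H →L[ℝ] H) : Measure H :=
  centeredGaussian (covOp S Q (Ioi 0))

/-- The Ornstein-Uhlenbeck transition semigroup. The solution at time `t`, started from `x`, of
`dZ = A Z dt + √Q dW`, where `A` generates `S`, is Gaussian with mean `S(t) x` and covariance
`Q_t`, so that `R_t φ (x) = E φ(Z(t, x)) = ∫ φ(S(t) x + y) N(0, Q_t)(dy)`. -/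
def transition {H : Type*} [NormedAddCommGroup H] [InnerProductSpace ℝ H] [CompleteSpace H]
    [MeasurableSpace H] (S : ℝ≥0 → H →L[ℝ] H) (Q : H →L[ℝ] H) (t : ℝ≥0) (φ : H → ℝ) (x : H) : ℝ :=
  ∫ y, φ (S t x + y) ∂(centeredGaussian (covOp S Q (Ioc 0 (t : ℝ))))

/-- Bounded Borel functions. -/
def IsBoundedBorel {H : Type*} [MeasurableSpace H] (φ : H → ℝ) : Prop :=
  Measurable φ ∧ ∃ C, ∀ x, |φ x| ≤ C

/-- `(R_t)` is symmetric with respect to `μ`: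
`∫ ψ R_t φ dμ = ∫ φ R_t ψ dμ` for all `t ≥ 0` and all bounded Borel `φ`, `ψ`. -/
def IsSymmetricTransition {H : Type*} [NormedAddCommGroup H] [InnerProductSpace ℝ H]
    [CompleteSpace H] [MeasurableSpace H] (S : ℝ≥0 → H →L[ℝ] H) (Q : H →L[ℝ] H) : Prop :=
  ∀ (t : ℝ≥0) (φ ψ : H → ℝ), IsBoundedBorel φ → IsBoundedBorel ψ →
    ∫ x, ψ x * transition S Q t φ x ∂(invariantMeasure S Q) =
      ∫ x, φ x * transition S Q t ψ x ∂(invariantMeasure S Q)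

/-- `R` is the extension of the transition semigroup from bounded Borel functions to bounded
operators on `L²(H, μ)`. Such an extension is unique, as bounded Borel functions are dense. -/
def IsL2Extension {H : Type*} [NormedAddCommGroup H] [InnerProductSpace ℝ H]
    [CompleteSpace H] [MeasurableSpace H] (S : ℝ≥0 → H →L[ℝ] H) (Q : H →L[ℝ] H)
    (R : ℝ≥0 → Lp ℝ 2 (invariantMeasure S Q) →L[ℝ] Lp ℝ 2 (invariantMeasure S Q)) : Prop :=
  ∀ (t : ℝ≥0) (φ : H → ℝ), IsBoundedBorel φ →
    ∀ f : Lp ℝ 2 (invariantMeasure S Q), f =ᵐ[invariantMeasure S Q] φ →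
      R t f =ᵐ[invariantMeasure S Q] transition S Q t φ

end OrnsteinUhlenbeck

end

set_option linter.unusedSectionVars false

namespace OrnsteinUhlenbeck

/-! ### Square roots of positive operators on a real Hilbert space -/

section Sqrt

/-! The functions E_h(x) = exp(⟪Q_∞ h, h⟫/2) (cos ⟪x, h⟫ + sin ⟪x, h⟫) are a real substitute for
exponential vectors: they are total in L²(μ), satisfy ⟪E_h, E_k⟫ = exp ⟪Q_∞ h, k⟫, and R_t E_h =
E_{S*(t)h}. Hence R_t is the second quantization of the contraction S_0(t) sending Q_∞^{1/2} h to
Q_∞^{1/2} S*(t) h, and symmetry of R_t says that S_0(t) is selfadjoint.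

Since Q_∞ = Q_t + S(t) Q_∞ S*(t) (`inner_covInf_eq_add`), the norm of S_0(t)^n on the range of
Q_∞^{1/2} is the square root of a tail of a convergent integral, so S_0(t)^n tends strongly to 0. A
compact selfadjoint operator with this property has norm below 1 (`exists_eigenbasis_lt_one`). Its
second quantization is diagonal on Fock space, with finite products of eigenvalues as entries; these
accumulate only at 0, so it is compact (`isCompactOperator_secondQuantization`). Conversely S_0(t)
is the restriction of R_t to the first chaos, recovered by differentiating exponential vectors at 0
(`isCompactOperator_of_secondQuantization`). Thus R_t is compact exactly when S_0(t) is.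

It remains to compare S_0 with S_Q. Differentiating the symmetry of Q_t S*(r) at t = 0 gives Q S*(r)
= S(r) Q (`inner_symm`). So S_Q(t) sends Q^{1/2} x to Q^{1/2} S*(t) x, and both semigroups are
copies of S*, one in the form norm of Q and one in that of Q_∞. A convexity argument makes S_Q
contractive (`inner_adjoint_le`), whence t ⟪Q S*(t)x, S*(t)x⟫ ≤ ⟪Q_∞ x, x⟫: S*(t) smooths from the
form norm of Q_∞ to that of Q. The reverse bound Q_∞ ≤ c Q holds if ‖S_0(1)‖ < 1 and also if S_Q is
exponentially stable. Factoring each semigroup through the other transfers compactness both ways,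
and decay from S_0 to S_Q. -/

/-- The Taylor coefficients of `x ↦ 1 - √(1 - x)`, shifted by one. -/
noncomputable def sqrtCoeff (n : ℕ) : ℝ := 2 * catalan n / 4 ^ (n + 1)

lemma sqrtCoeff_nonneg (n : ℕ) : 0 ≤ sqrtCoeff n := by
  unfold sqrtCoeff; positivity

/-- The telescoping form, from the two recurrences for central binomial coefficients; it bounds the
partial sums by 1. -/
lemma sqrtCoeff_eq_sub (n : ℕ) :
    sqrtCoeff n = (n.centralBinom : ℝ) / 4 ^ n - ((n + 1).centralBinom : ℝ) / 4 ^ (n + 1) := by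
  have h1 : ((n : ℝ) + 1) * catalan n = n.centralBinom := by
    exact_mod_cast succ_mul_catalan_eq_centralBinom n
  have h2 : ((n : ℝ) + 1) * (n + 1).centralBinom = 2 * (2 * n + 1) * n.centralBinom := by
    exact_mod_cast Nat.succ_mul_centralBinom_succ n
  have h3 : ((n : ℝ) + 1) ≠ 0 := by positivity
  have h4 : ((n + 1).centralBinom : ℝ) = 2 * (2 * n + 1) * catalan n := by
    apply mul_left_cancel₀ h3
    rw [h2, ← h1]; ring
  rw [sqrtCoeff, h4, ← h1, pow_succ]
  field_simp
  ring

lemma sum_sqrtCoeff_le_one (N : ℕ) : ∑ n ∈ Finset.range N, sqrtCoeff n ≤ 1 := by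
  have : ∑ n ∈ Finset.range N, sqrtCoeff n = 1 - (N.centralBinom : ℝ) / 4 ^ N := by
    simp_rw [sqrtCoeff_eq_sub]
    rw [Finset.sum_range_sub']
    simp
  rw [this]
  have : (0 : ℝ) ≤ (N.centralBinom : ℝ) / 4 ^ N := by positivity
  linarith

lemma summable_sqrtCoeff : Summable sqrtCoeff :=
  summable_of_sum_range_le sqrtCoeff_nonneg sum_sqrtCoeff_le_one

lemma tsum_sqrtCoeff_le_one : ∑' n, sqrtCoeff n ≤ 1 :=
  Real.tsum_le_of_sum_range_le sqrtCoeff_nonneg sum_sqrtCoeff_le_one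

/-- The Catalan recurrence. It is the coefficient form of Y² = 2Y - A for Y = 1 - √(1 - A). -/
lemma sum_antidiagonal_sqrtCoeff (n : ℕ) :
    ∑ p ∈ Finset.HasAntidiagonal.antidiagonal n, sqrtCoeff p.1 * sqrtCoeff p.2 =
      2 * sqrtCoeff (n + 1) := by
  have h : (catalan (n + 1) : ℝ) =
      ∑ p ∈ Finset.HasAntidiagonal.antidiagonal n, (catalan p.1 : ℝ) * catalan p.2 := by
    rw [catalan_succ']; push_cast; rfl
  rw [sqrtCoeff, h, Finset.mul_sum, Finset.sum_div, Finset.mul_sum]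
  refine Finset.sum_congr rfl fun p hp => ?_
  rw [Finset.HasAntidiagonal.mem_antidiagonal] at hp
  subst hp
  simp only [sqrtCoeff]
  field_simp
  ring

variable {H : Type*} [NormedAddCommGroup H] [InnerProductSpace ℝ H] [CompleteSpace H]

/-- The binomial series Y for 1 - √(1 - A) converges absolutely even at ‖A‖ = 1, because its
coefficients sum to at most 1. The Cauchy product gives Y² = 2Y - A, that is (1 - Y)² = 1 - A, and
‖Y‖ ≤ 1 makes 1 - Y positive. -/
lemma exists_isPositive_sq_eq_one_sub (A : H →L[ℝ] H) (hA : IsSelfAdjoint A) (h : ‖A‖ ≤ 1) :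
    ∃ B : H →L[ℝ] H, B.IsPositive ∧ B ∘L B = 1 - A := by
  set f : ℕ → H →L[ℝ] H := fun n => sqrtCoeff n • A ^ (n + 1) with hf
  have hbd : ∀ n, ‖f n‖ ≤ sqrtCoeff n := fun n => by
    rw [hf]; simp only [norm_smul, Real.norm_of_nonneg (sqrtCoeff_nonneg n)]
    have : ‖A ^ (n + 1)‖ ≤ 1 :=
      (norm_pow_le' A n.succ_pos).trans (pow_le_one₀ (norm_nonneg _) h)
    nlinarith [sqrtCoeff_nonneg n]
  have hns : Summable fun n => ‖f n‖ :=
    Summable.of_nonneg_of_le (fun _ => norm_nonneg _) hbd summable_sqrtCoeff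
  have hs : Summable f := hns.of_norm
  set Y := ∑' n, f n with hY
  have hYn : ‖Y‖ ≤ 1 := (tsum_of_norm_bounded summable_sqrtCoeff.hasSum hbd).trans
    tsum_sqrtCoeff_le_one
  have hYs : IsSelfAdjoint Y := by
    have : ∀ n, star (f n) = f n := fun n => by
      simp [hf, star_smul, star_pow, hA.star_eq]
    rw [IsSelfAdjoint, hY, tsum_star]
    simp_rw [this]
  have hYY : Y * Y = 2 • Y - A := by
    rw [hY, tsum_mul_tsum_eq_tsum_sum_antidiagonal_of_summable_norm hns hns]
    have : ∀ n, ∑ p ∈ Finset.HasAntidiagonal.antidiagonal n, f p.1 * f p.2 =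
        2 • f (n + 1) := fun n => by
      have : ∀ p ∈ Finset.HasAntidiagonal.antidiagonal n,
          f p.1 * f p.2 = (sqrtCoeff p.1 * sqrtCoeff p.2) • A ^ (n + 2) := fun p hp => by
        rw [Finset.HasAntidiagonal.mem_antidiagonal] at hp
        subst hp
        simp only [hf, smul_mul_smul_comm, ← pow_add]
        congr 2; ring
      rw [Finset.sum_congr rfl this, ← Finset.sum_smul, sum_antidiagonal_sqrtCoeff]
      simp only [hf, mul_smul, two_smul]
    simp_rw [this]
    have h2 : ∑' n, 2 • f (n + 1) = 2 • ∑' n, f (n + 1) :=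
      ((summable_nat_add_iff 1).2 hs).tsum_const_smul 2
    rw [h2, hs.tsum_eq_zero_add]
    have h0 : f 0 = (1 / 2 : ℝ) • A := by simp [hf, sqrtCoeff]; norm_num
    rw [h0, smul_add, ← Nat.cast_smul_eq_nsmul ℝ 2 ((1 / 2 : ℝ) • A), smul_smul]
    norm_num
  refine ⟨1 - Y, ?_, ?_⟩
  · rw [ContinuousLinearMap.isPositive_iff']
    refine ⟨(IsSelfAdjoint.one _).sub hYs, fun x => ?_⟩
    have : ⟪Y x, x⟫_ℝ ≤ ‖x‖ * ‖x‖ := (real_inner_le_norm _ _).trans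
      (mul_le_mul_of_nonneg_right ((Y.le_opNorm x).trans
        (mul_le_of_le_one_left (norm_nonneg _) hYn)) (norm_nonneg _))
    simp only [sub_apply, one_apply_eq_self, inner_sub_left,
      real_inner_self_eq_norm_mul_norm]
    linarith
  · change (1 - Y) * (1 - Y) = 1 - A
    rw [sub_mul, mul_sub, mul_sub, hYY]
    simp only [one_mul, mul_one, two_smul]
    abel

/-- A positive operator bounded by the identity in the sense of forms, subtracted from the
identity, is a contraction. -/
lemma norm_one_sub_le_one {Q : H →L[ℝ] H} (hQ : Q.IsPositive) (h : ‖Q‖ ≤ 1) : ‖1 - Q‖ ≤ 1 := by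
  have hs : (1 - Q : H →L[ℝ] H).IsSymmetric := by
    have := ((IsSelfAdjoint.one (H →L[ℝ] H)).sub hQ.isSelfAdjoint)
    exact this.isSymmetric
  rw [ContinuousLinearMap.norm_eq_iSup_rayleighQuotient _ hs]
  refine Real.iSup_le (fun x => ?_) zero_le_one
  rw [ContinuousLinearMap.rayleighQuotient, ContinuousLinearMap.reApplyInnerSelf_apply, abs_div,
    abs_of_nonneg (sq_nonneg ‖x‖)]
  refine div_le_one_of_le₀ ?_ (sq_nonneg _)
  have h1 : 0 ≤ ⟪Q x, x⟫_ℝ := hQ.inner_nonneg_left x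
  have h2 : ⟪Q x, x⟫_ℝ ≤ ‖x‖ * ‖x‖ := (real_inner_le_norm _ _).trans
      (mul_le_mul_of_nonneg_right ((Q.le_opNorm x).trans
        (mul_le_of_le_one_left (norm_nonneg _) h)) (norm_nonneg _))
  simp only [sub_apply, one_apply_eq_self, inner_sub_left,
    real_inner_self_eq_norm_mul_norm, RCLike.re_to_real]
  rw [abs_le]
  constructor <;> nlinarith [norm_nonneg x]

theorem exists_isPositive_sq_eq {Q : H →L[ℝ] H} (hQ : Q.IsPositive) :
    ∃ B : H →L[ℝ] H, B.IsPositive ∧ B ∘L B = Q := by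
  by_cases h0 : ‖Q‖ = 0
  · rw [norm_eq_zero] at h0
    exact ⟨0, ContinuousLinearMap.isPositive_zero, by simp [h0]⟩
  have hpos : 0 < ‖Q‖ := lt_of_le_of_ne (norm_nonneg _) (Ne.symm h0)
  have hq : (‖Q‖⁻¹ • Q).IsPositive := hQ.smul_of_nonneg (by positivity)
  have hqn : ‖‖Q‖⁻¹ • Q‖ ≤ 1 := by
    rw [norm_smul, norm_inv, norm_norm, inv_mul_cancel₀ h0]
  -- After normalisation Q/‖Q‖ = 1 - A with A = 1 - Q/‖Q‖ a contraction.
  obtain ⟨B, hB, hBB⟩ := exists_isPositive_sq_eq_one_sub (1 - ‖Q‖⁻¹ • Q)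
    ((IsSelfAdjoint.one _).sub hq.isSelfAdjoint) (norm_one_sub_le_one hq hqn)
  refine ⟨Real.sqrt ‖Q‖ • B, hB.smul_of_nonneg (by positivity), ?_⟩
  rw [ContinuousLinearMap.smul_comp, ContinuousLinearMap.comp_smul, hBB, smul_smul,
    Real.mul_self_sqrt (norm_nonneg _), sub_sub_cancel, smul_smul, mul_inv_cancel₀ h0, one_smul]

theorem posSqrt_spec {Q : H →L[ℝ] H} (hQ : Q.IsPositive) :
    (posSqrt Q).IsPositive ∧ posSqrt Q ∘L posSqrt Q = Q :=
  Classical.epsilon_spec (p := fun B : H →L[ℝ] H => B.IsPositive ∧ B ∘L B = Q)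
    (exists_isPositive_sq_eq hQ)

lemma norm_posSqrt_sq {Q : H →L[ℝ] H} (hQ : Q.IsPositive) (x : H) :
    ‖posSqrt Q x‖ ^ 2 = ⟪Q x, x⟫_ℝ := by
  obtain ⟨h1, h2⟩ := posSqrt_spec hQ
  rw [← real_inner_self_eq_norm_sq, h1.inner_left_eq_inner_right, real_inner_comm]
  exact congrArg (⟪· , x⟫_ℝ) (DFunLike.congr_fun h2 x)

lemma inner_posSqrt {Q : H →L[ℝ] H} (hQ : Q.IsPositive) (x y : H) :
    ⟪posSqrt Q x, posSqrt Q y⟫_ℝ = ⟪Q x, y⟫_ℝ := by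
  obtain ⟨h1, h2⟩ := posSqrt_spec hQ
  rw [← h1.inner_left_eq_inner_right]
  exact congrArg (⟪· , y⟫_ℝ) (DFunLike.congr_fun h2 x)

lemma posSqrt_injective {Q : H →L[ℝ] H} (hQ : Q.IsPositive) (hinj : Function.Injective Q) :
    Function.Injective (posSqrt Q) := by
  have h2 := (posSqrt_spec hQ).2
  have : Function.Injective (posSqrt Q ∘ posSqrt Q) := by
    rw [← ContinuousLinearMap.coe_comp, h2]; exact hinj
  exact this.of_comp

/-- An injective selfadjoint operator has dense range. -/
lemma denseRange_of_injective {P : H →L[ℝ] H} (hP : P.IsPositive)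
    (hinj : Function.Injective P) : DenseRange P := by
  have h : (LinearMap.range (P : H →ₗ[ℝ] H))ᗮ = ⊥ := by
    rw [eq_bot_iff]
    intro x hx
    have : P x = 0 := by
      rw [← inner_self_eq_zero (𝕜 := ℝ), hP.inner_left_eq_inner_right, real_inner_comm]
      exact hx _ ⟨P x, rfl⟩
    exact hinj (by simpa using this)
  have := (Submodule.topologicalClosure_eq_top_iff
    (K := LinearMap.range (P : H →ₗ[ℝ] H))).2 h
  exact Submodule.dense_iff_topologicalClosure_eq_top.2 this

lemma denseRange_posSqrt {Q : H →L[ℝ] H} (hQ : Q.IsPositive) (hinj : Function.Injective Q) :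
    DenseRange (posSqrt Q) :=
  denseRange_of_injective (posSqrt_spec hQ).1 (posSqrt_injective hQ hinj)

end Sqrt

/-! ### Factoring bounded operators through operators with dense range -/

/-- The bound makes f factor through the range of e, and density extends the factor. Comparing two
quadratic forms thus yields an operator, which is how all semigroups on forms arise below. -/
lemma exists_factor {E X Y : Type*} [AddCommGroup E] [Module ℝ E] [NormedAddCommGroup X]
    [NormedSpace ℝ X] [NormedAddCommGroup Y] [NormedSpace ℝ Y] [CompleteSpace Y]
    (e : E →ₗ[ℝ] X) (f : E →ₗ[ℝ] Y) (he : DenseRange e) {C : ℝ} (hC : 0 ≤ C)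
    (h : ∀ x, ‖f x‖ ≤ C * ‖e x‖) : ∃ V : X →L[ℝ] Y, (∀ x, V (e x) = f x) ∧ ‖V‖ ≤ C :=
  ⟨f.extendOfNorm e, fun x => LinearMap.extendOfNorm_eq he ⟨C, h⟩ x,
    LinearMap.opNorm_extendOfNorm_le he hC h⟩

/-! ### Eigenbases of compact selfadjoint operators -/

section Eigenbasis

universe u

/-- Orthonormal bases of the mutually orthogonal eigenspaces are put together; the spectral theorem
says nothing is orthogonal to all eigenspaces. -/
theorem exists_eigenbasis {H : Type u} [NormedAddCommGroup H] [InnerProductSpace ℝ H]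
    [CompleteSpace H] {T : H →L[ℝ] H} (hT : IsCompactOperator T) (hs : T.IsSymmetric) :
    ∃ (ι : Type u) (b : HilbertBasis ι ℝ H) (l : ι → ℝ), ∀ i, T (b i) = l i • b i := by
  classical
  let E : ℝ → Submodule ℝ H := fun μ => Module.End.eigenspace (T : Module.End ℝ H) μ
  have hcl : ∀ μ, IsClosed (E μ : Set H) := fun μ => by
    have : (E μ : Set H) = {x | T x = μ • x} := by
      ext x; exact Module.End.mem_eigenspace_iff
    rw [this]
    exact isClosed_eq T.continuous (continuous_const_smul μ)
  have hcs : ∀ μ, CompleteSpace (E μ) := fun μ => (hcl μ).completeSpace_coe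
  choose w b hb using fun μ => exists_hilbertBasis ℝ (E μ)
  have ho : OrthogonalFamily ℝ (fun μ => E μ) fun μ => (E μ).subtypeₗᵢ :=
    LinearMap.IsSymmetric.orthogonalFamily_eigenspaces hs
  have hon : Orthonormal ℝ fun p : Σ μ, w μ => ((b p.1 p.2 : E p.1) : H) :=
    ho.orthonormal_sigma_orthonormal (v_family := fun μ i => b μ i) fun μ => (b μ).orthonormal
  have hbot : (Submodule.span ℝ (Set.range fun p : Σ μ, w μ => ((b p.1 p.2 : E p.1) : H)))ᗮ
      = ⊥ := by
    rw [eq_bot_iff, ← ContinuousLinearMap.orthogonalComplement_iSup_eigenspaces_eq_bot hT hs]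
    intro x hx
    rw [Submodule.mem_orthogonal'] at hx ⊢
    intro u hu
    have hle : (⨆ μ, E μ) ≤ (Submodule.span ℝ {x})ᗮ := by
      refine iSup_le fun μ v hv => ?_
      rw [Submodule.mem_orthogonal_singleton_iff_inner_right]
      have hsum := (b μ).hasSum_repr ⟨v, hv⟩
      have h2 := (hsum.mapL ((innerSL ℝ x) ∘L (E μ).subtypeL))
      have h3 : ∀ i, ((innerSL ℝ x) ∘L (E μ).subtypeL)
          ((b μ).repr ⟨v, hv⟩ i • (b μ) i) = 0 := fun i => by
        have := hx _ (Submodule.subset_span ⟨⟨μ, i⟩, rfl⟩)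
        simp only [ContinuousLinearMap.comp_apply, map_smul, Submodule.subtypeL_apply,
          innerSL_apply_apply, smul_eq_mul]
        simp only at this
        rw [this, mul_zero]
      simp_rw [h3] at h2
      simpa using h2.unique hasSum_zero
    exact (Submodule.mem_orthogonal_singleton_iff_inner_right).1 (hle hu)
  refine ⟨Σ μ, w μ, HilbertBasis.mkOfOrthogonalEqBot hon hbot, fun p => p.1, fun p => ?_⟩
  rw [HilbertBasis.coe_mkOfOrthogonalEqBot]
  exact Module.End.mem_eigenspace_iff.1 (b p.1 p.2).2

/-- The eigenvalues of a compact operator along an orthonormal family of eigenvectors tend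
to zero. -/
theorem finite_setOf_le_eigenvalue {H : Type*} [NormedAddCommGroup H] [InnerProductSpace ℝ H]
    {T : H →L[ℝ] H} (hT : IsCompactOperator T) {ι : Type*}
    {b : ι → H} (hb : Orthonormal ℝ b) {l : ι → ℝ} (hl : ∀ i, T (b i) = l i • b i) {ε : ℝ}
    (hε : 0 < ε) : {i | ε ≤ |l i|}.Finite := by
  by_contra hinf
  have hinf : {i | ε ≤ |l i|}.Infinite := hinf
  let e := hinf.natEmbedding
  have hK := hT.isCompact_closure_image_closedBall (f := (T : H →ₗ[ℝ] H)) 1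
  have hmem : ∀ n, T (b (e n)) ∈ closure ((T : H →ₗ[ℝ] H) '' Metric.closedBall 0 1) := fun n =>
    subset_closure ⟨b (e n), by simp [hb.1], rfl⟩
  obtain ⟨a, -, φ, hφ, hlim⟩ := hK.tendsto_subseq hmem
  have hc := hlim.cauchySeq
  rw [Metric.cauchySeq_iff'] at hc
  obtain ⟨N, hN⟩ := hc ε hε
  have h1 := hN (N + 1) (Nat.le_succ N)
  have hne : (e (φ (N + 1)) : ι) ≠ e (φ N) := fun h =>
    absurd (hφ.injective (e.injective (Subtype.ext h))) (Nat.succ_ne_self N)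
  have hge : ε ≤ |l (e (φ (N + 1)))| := (e (φ (N + 1))).2
  -- Images of distinct orthonormal eigenvectors are at distance at least ε, so no subsequence is
  -- Cauchy.
  have h2 : dist (T (b (e (φ (N + 1))))) (T (b (e (φ N)))) ^ 2
      = l (e (φ (N + 1))) ^ 2 + l (e (φ N)) ^ 2 := by
    rw [dist_eq_norm, hl, hl, @norm_sub_sq_real, real_inner_smul_left, real_inner_smul_right,
      hb.2 hne, norm_smul, norm_smul, hb.1, hb.1]
    simp
  have h3 : dist (T (b (e (φ (N + 1))))) (T (b (e (φ N)))) ^ 2 < ε ^ 2 := by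
    have : (0:ℝ) ≤ dist (T (b (e (φ (N + 1))))) (T (b (e (φ N)))) := dist_nonneg
    exact pow_lt_pow_left₀ h1 this two_ne_zero
  have h4 : ε ^ 2 ≤ l (e (φ (N + 1))) ^ 2 := by
    rw [← sq_abs (l _)]; exact pow_le_pow_left₀ hε.le hge 2
  nlinarith [sq_nonneg (l (e (φ N)))]

end Eigenbasis

end OrnsteinUhlenbeck

namespace OrnsteinUhlenbeck

/-! ### Families with the same Gram matrix -/

section Gram

variable {X Y : Type*} [NormedAddCommGroup X] [InnerProductSpace ℝ X] [CompleteSpace X]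
  [NormedAddCommGroup Y] [InnerProductSpace ℝ Y] [CompleteSpace Y]

/-- The Gram matrix determines the norm of every finite linear combination, so a i ↦ b i extends
isometrically. -/
theorem exists_isometry_of_gram {α : Type*} (a : α → X) (b : α → Y)
    (h : ∀ i j, ⟪b i, b j⟫_ℝ = ⟪a i, a j⟫_ℝ) (ha : Dense (Submodule.span ℝ (range a) : Set X)) :
    ∃ J : X →L[ℝ] Y, (∀ i, J (a i) = b i) ∧ J.adjoint ∘L J = ContinuousLinearMap.id ℝ X := by
  set e := Finsupp.linearCombination ℝ a with he
  set f := Finsupp.linearCombination ℝ b with hf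
  have hef : ∀ c, ‖f c‖ = ‖e c‖ := fun c => by
    have : ⟪f c, f c⟫_ℝ = ⟪e c, e c⟫_ℝ := by
      simp only [he, hf, Finsupp.linearCombination_apply, Finsupp.sum, sum_inner, inner_sum,
        real_inner_smul_left, real_inner_smul_right, h]
    rw [real_inner_self_eq_norm_sq, real_inner_self_eq_norm_sq] at this
    exact (sq_eq_sq₀ (norm_nonneg _) (norm_nonneg _)).1 this
  have hd : DenseRange e := by
    have : range e = (Submodule.span ℝ (range a) : Set X) := by
      rw [← LinearMap.coe_range, he, Finsupp.range_linearCombination]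
    rw [DenseRange, this]; exact ha
  obtain ⟨J, hJ, -⟩ := exists_factor e f hd zero_le_one fun c => by rw [one_mul, hef]
  refine ⟨J, fun i => ?_, ?_⟩
  · simpa [he, hf] using hJ (Finsupp.single i 1)
  · refine (ContinuousLinearMap.norm_map_iff_adjoint_comp_self J).1 fun x => ?_
    refine hd.induction_on (p := fun x => ‖J x‖ = ‖x‖) x ?_ fun c => ?_
    · exact isClosed_eq (by fun_prop) (by fun_prop)
    · rw [hJ, hef]

end Gram

/-! ### The first chaos -/

section FirstChaos

variable {H X : Type*} [NormedAddCommGroup H] [InnerProductSpace ℝ H] [CompleteSpace H]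
  [NormedAddCommGroup X] [InnerProductSpace ℝ X] [CompleteSpace X]

open Filter Topology in
lemma tendsto_mul_exp_div_sub_one (a : ℝ) :
    Tendsto (fun N : ℝ => N * (Real.exp (a / N) - 1)) atTop (𝓝 a) := by
  have h1 : HasDerivAt (fun t : ℝ => Real.exp (a * t)) a 0 := by
    have := (((hasDerivAt_id (0 : ℝ)).const_mul a).exp)
    simpa using this
  have h2 := h1.tendsto_slope_zero_right.comp tendsto_inv_atTop_nhdsGT_zero
  refine h2.congr fun N => ?_
  simp [div_eq_mul_inv]

open Filter Topology in
-- The vectors r (F(h/r) - F(0)) are difference quotients of the exponential map at 0. Their inner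
-- products r s (exp(⟪Ph, Pk⟫/(r s)) - 1) tend to ⟪Ph, Pk⟫ as r, s → ∞, so they are Cauchy, and the
-- limit G h is the first chaos component.
lemma exists_limit_of_exp_gram (F : H → X) (P : H →L[ℝ] H)
    (hF : ∀ h k, ⟪F h, F k⟫_ℝ = Real.exp ⟪P h, P k⟫_ℝ) (r : ℕ → ℝ) (hr : Tendsto r atTop atTop)
    (hr0 : ∀ m, r m ≠ 0) :
    ∃ G : H → X, (∀ h k, ⟪G h, G k⟫_ℝ = ⟪P h, P k⟫_ℝ) ∧
      ∀ h, Tendsto (fun m => r m • (F ((r m)⁻¹ • h) - F 0)) atTop (𝓝 (G h)) := by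
  obtain ⟨x, hxdef⟩ : ∃ x : ℕ → H → X, ∀ m h, x m h = r m • (F ((r m)⁻¹ • h) - F 0) :=
    ⟨_, fun _ _ => rfl⟩
  have hx : ∀ m n h k, ⟪x m h, x n k⟫_ℝ =
      (r m * r n) * (Real.exp (⟪P h, P k⟫_ℝ / (r m * r n)) - 1) := by
    intro m n h k
    simp only [hxdef, real_inner_smul_left, real_inner_smul_right, inner_sub_left, inner_sub_right,
      hF,
      map_smul, map_zero, inner_zero_left, inner_zero_right, Real.exp_zero]
    rw [show (r n)⁻¹ * ((r m)⁻¹ * ⟪P h, P k⟫_ℝ) = ⟪P h, P k⟫_ℝ / (r m * r n) by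
      have := hr0 m; have := hr0 n; field_simp]
    ring
  have hlim : ∀ h k, Tendsto (fun p : ℕ × ℕ => ⟪x p.1 h, x p.2 k⟫_ℝ) atTop
      (𝓝 ⟪P h, P k⟫_ℝ) := by
    intro h k
    simp only [hx]
    refine (tendsto_mul_exp_div_sub_one _).comp ?_
    rw [← prod_atTop_atTop_eq]
    exact (hr.comp tendsto_fst).atTop_mul_atTop₀ (hr.comp tendsto_snd)
  have hdiag : ∀ h k, Tendsto (fun m : ℕ => ⟪x m h, x m k⟫_ℝ) atTop (𝓝 ⟪P h, P k⟫_ℝ) :=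
    fun h k => (hlim h k).comp (tendsto_atTop_diagonal)
  have hcauchy : ∀ h, CauchySeq fun m => x m h := by
    intro h
    rw [cauchySeq_iff_tendsto_dist_atTop_0]
    have h1 : Tendsto (fun p : ℕ × ℕ => ⟪x p.1 h, x p.1 h⟫_ℝ - 2 * ⟪x p.1 h, x p.2 h⟫_ℝ
        + ⟪x p.2 h, x p.2 h⟫_ℝ) atTop
        (𝓝 (⟪P h, P h⟫_ℝ - 2 * ⟪P h, P h⟫_ℝ + ⟪P h, P h⟫_ℝ)) := by
      refine ((Tendsto.comp (hdiag h h) ?_).sub ((hlim h h).const_mul 2)).add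
        (Tendsto.comp (hdiag h h) ?_)
      · rw [← prod_atTop_atTop_eq]; exact tendsto_fst
      · rw [← prod_atTop_atTop_eq]; exact tendsto_snd
    have h2 := h1.sqrt
    rw [show ⟪P h, P h⟫_ℝ - 2 * ⟪P h, P h⟫_ℝ + ⟪P h, P h⟫_ℝ = 0 by ring, Real.sqrt_zero] at h2
    refine h2.congr fun p => ?_
    rw [dist_eq_norm, ← Real.sqrt_sq (norm_nonneg (x p.1 h - x p.2 h)), @norm_sub_sq_real,
      real_inner_self_eq_norm_sq, real_inner_self_eq_norm_sq]
  choose G hG using fun h => cauchySeq_tendsto_of_complete (hcauchy h)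
  refine ⟨G, fun h k => tendsto_nhds_unique ((hG h).inner (hG k)) (hdiag h k), fun h => ?_⟩
  simpa only [hxdef] using hG h

open Filter Topology in
/-- If vectors `F h` have the Gram matrix of exponential vectors, and `R` acts on them as a second
quantized operator, then compactness of `R` implies that of its one particle restriction. -/
theorem isCompactOperator_of_secondQuantization (F : H → X) (P A T : H →L[ℝ] H) (R : X →L[ℝ] X)
    (hP : DenseRange P) (hF : ∀ h k, ⟪F h, F k⟫_ℝ = Real.exp ⟪P h, P k⟫_ℝ)
    (hR : ∀ h, R (F h) = F (A h)) (hT : ∀ h, T (P h) = P (A h)) (hc : IsCompactOperator R) :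
    IsCompactOperator T := by
  obtain ⟨G, hGram, hG⟩ := exists_limit_of_exp_gram F P hF (fun m => (m : ℝ) + 1)
    (tendsto_natCast_atTop_atTop.atTop_add tendsto_const_nhds) fun m => by positivity
  -- R maps the difference quotient of h to that of A h, since A is linear and R fixes F 0.
  have hRG : ∀ h, R (G h) = G (A h) := fun h => by
    refine tendsto_nhds_unique (((R.continuous.tendsto _).comp (hG h))) ((hG (A h)).congr ?_)
    intro m
    simp only [Function.comp_apply, map_smul, map_sub, hR, map_zero]
  obtain ⟨W, hW, hWW⟩ := exists_isometry_of_gram P G hGram (by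
    refine Dense.mono Submodule.subset_span hP)
  -- W identifies H with the first chaos, where R W = W T; W* W = 1 then isolates T.
  have hTW : T = W.adjoint ∘L R ∘L W := by
    refine DFunLike.coe_injective (hP.equalizer T.continuous
      (ContinuousLinearMap.continuous _) (funext fun h => ?_))
    have := DFunLike.congr_fun hWW (P (A h))
    simp only [ContinuousLinearMap.comp_apply, ContinuousLinearMap.id_apply] at this
    simp only [Function.comp_apply, ContinuousLinearMap.comp_apply, hW, hRG, hT]
    rw [← hW, this]
  rw [hTW]
  exact (hc.comp_clm W).clm_comp W.adjoint

end FirstChaos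

/-! ### Diagonal operators on `ℓ²` -/

section Diagonal

variable {κ : Type*}

lemma lp_hasSum_sq (f : lp (fun _ : κ => ℝ) 2) : HasSum (fun k => f k ^ 2) (‖f‖ ^ 2) := by
  have h := lp.hasSum_inner (𝕜 := ℝ) f f
  rw [real_inner_self_eq_norm_sq] at h
  simpa only [real_inner_self_eq_norm_sq, Real.norm_eq_abs, sq_abs] using h

lemma lp_norm_le_of_abs_le {f g : lp (fun _ : κ => ℝ) 2} {c : ℝ} (hc : 0 ≤ c)
    (h : ∀ k, |f k| ≤ c * |g k|) : ‖f‖ ≤ c * ‖g‖ := by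
  have h1 : ‖f‖ ^ 2 ≤ (c * ‖g‖) ^ 2 := by
    rw [mul_pow]
    refine hasSum_le (fun k => ?_) (lp_hasSum_sq f) ((lp_hasSum_sq g).mul_left (c ^ 2))
    rw [← sq_abs (f k), ← sq_abs (g k), ← mul_pow]
    exact pow_le_pow_left₀ (abs_nonneg _) (h k) 2
  exact le_of_sq_le_sq h1 (by positivity)

lemma memℓp_mul {d : κ → ℝ} {c : ℝ} (hd : ∀ k, |d k| ≤ c) (f : lp (fun _ : κ => ℝ) 2) :
    Memℓp (fun k => d k * f k) 2 := by
  have h2 : (0 : ℝ) < (2 : ℝ≥0∞).toReal := by norm_num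
  refine memℓp_gen ?_
  refine Summable.of_nonneg_of_le (fun k => by positivity) (fun k => ?_)
    (((lp.memℓp f).summable h2).mul_left (c ^ (2 : ℝ≥0∞).toReal))
  rw [norm_mul, Real.mul_rpow (norm_nonneg _) (norm_nonneg _)]
  exact mul_le_mul_of_nonneg_right
    (Real.rpow_le_rpow (norm_nonneg _) (hd k) h2.le) (by positivity)

/-- The operator of multiplication by a bounded sequence on `ℓ²`. -/
noncomputable def diagOp (d : κ → ℝ) (c : ℝ) (hd : ∀ k, |d k| ≤ c) :
    lp (fun _ : κ => ℝ) 2 →L[ℝ] lp (fun _ : κ => ℝ) 2 :=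
  LinearMap.mkContinuous
    { toFun := fun f => ⟨fun k => d k * f k, memℓp_mul hd f⟩
      map_add' := fun f g => by
        ext k; exact mul_add _ _ _
      map_smul' := fun a f => by
        ext k
        simp only [lp.coeFn_smul, Pi.smul_apply, smul_eq_mul, RingHom.id_apply]
        ring }
    |c| fun f => lp_norm_le_of_abs_le (abs_nonneg c) fun k => by
      simp only [LinearMap.coe_mk, AddHom.coe_mk, abs_mul]
      exact mul_le_mul_of_nonneg_right ((hd k).trans (le_abs_self c)) (abs_nonneg _)

lemma diagOp_apply {d : κ → ℝ} {c : ℝ} (hd : ∀ k, |d k| ≤ c) (f : lp (fun _ : κ => ℝ) 2) (k : κ) :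
    diagOp d c hd f k = d k * f k := rfl

/-- A norm limit of finite rank operators: keeping the finitely many entries of modulus at least ε/2
leaves an error of norm at most ε/2. -/
theorem isCompactOperator_diagOp {d : κ → ℝ} {c : ℝ} (hd : ∀ k, |d k| ≤ c)
    (h : ∀ ε > 0, {k | ε ≤ |d k|}.Finite) : IsCompactOperator (diagOp d c hd) := by
  classical
  have hcl := (isClosed_setOfPred_isCompactOperator (𝕜₁ := ℝ) (σ₁₂ := RingHom.id ℝ)
    (M₁ := lp (fun _ : κ => ℝ) 2) (M₂ := lp (fun _ : κ => ℝ) 2))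
  refine hcl.closure_subset (Metric.mem_closure_iff.2 fun ε hε => ?_)
  let s := (h (ε / 2) (half_pos hε)).toFinset
  let e : κ → lp (fun _ : κ => ℝ) 2 := fun k => lp.single 2 k (1 : ℝ)
  let D : lp (fun _ : κ => ℝ) 2 →L[ℝ] lp (fun _ : κ => ℝ) 2 :=
    ∑ k ∈ s, (ContinuousLinearMap.toSpanSingleton ℝ (d k • e k)) ∘L innerSL ℝ (e k)
  have hD : IsCompactOperator D := by
    have : D ∈ compactOperator (RingHom.id ℝ) (lp (fun _ : κ => ℝ) 2)
        (lp (fun _ : κ => ℝ) 2) :=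
      Submodule.sum_mem _ fun k _ =>
        (isCompactOperator_of_locallyCompactSpace_rng
          (ContinuousLinearMap.toSpanSingleton ℝ (d k • e k))).comp_clm (innerSL ℝ (e k))
    exact this
  refine ⟨D, hD, ?_⟩
  rw [dist_eq_norm]
  refine lt_of_le_of_lt (ContinuousLinearMap.opNorm_le_bound _ (half_pos hε).le fun f => ?_)
    (half_lt_self hε)
  refine lp_norm_le_of_abs_le (half_pos hε).le fun k => ?_
  have hDk : D f k = if k ∈ s then d k * f k else 0 := by
    have h1 : D f = ∑ j ∈ s, f j • d j • e j := by
      simp only [D, sum_apply, ContinuousLinearMap.comp_apply,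
        ContinuousLinearMap.toSpanSingleton_apply, innerSL_apply_apply, e, lp.inner_single_left]
      simp
    rw [h1, lp.coeFn_sum, Finset.sum_apply]
    simp only [lp.coeFn_smul, Pi.smul_apply, smul_eq_mul, e, lp.single_apply, Pi.single_apply,
      mul_ite, mul_one, mul_zero, Finset.sum_ite_eq]
    split_ifs <;> ring
  rw [sub_apply, lp.coeFn_sub, Pi.sub_apply, diagOp_apply, hDk]
  split_ifs with hk
  · simp; positivity
  · rw [sub_zero, abs_mul]
    refine mul_le_mul_of_nonneg_right ?_ (abs_nonneg _)
    have : ¬ (ε / 2 ≤ |d k|) := by simpa [s] using hk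
    linarith

end Diagonal

end OrnsteinUhlenbeck

namespace OrnsteinUhlenbeck

/-! ### Fock space -/

section Fock

variable {ι : Type*}

/-- Expansion of the n-th power over n-tuples of indices, by splitting off the first index. -/
lemma summable_and_hasSum_pi_prod {f : ι → ℝ} (hf : Summable fun i => ‖f i‖) (n : ℕ) :
    (Summable fun i : Fin n → ι => ‖∏ j, f (i j)‖) ∧
      HasSum (fun i : Fin n → ι => ∏ j, f (i j)) ((∑' i, f i) ^ n) := by
  induction n with
  | zero =>
    refine ⟨(hasSum_unique _).summable, ?_⟩
    simp
  | succ n ih =>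
    have h1 : Summable fun p : ι × (Fin n → ι) => ‖f p.1 * ∏ j, f (p.2 j)‖ :=
      Summable.mul_norm (f := f) (g := fun i : Fin n → ι => ∏ j, f (i j)) hf ih.1
    have h2 := hf.of_norm.hasSum.mul ih.2 h1.of_norm
    have he : ∀ p : ι × (Fin n → ι),
        ∏ j, f (Fin.consEquiv (fun _ => ι) p j) = f p.1 * ∏ j, f (p.2 j) := fun p => by
      rw [Fin.prod_univ_succ]; simp [Fin.consEquiv]
    constructor
    · rw [← (Fin.consEquiv fun _ => ι).summable_iff]
      simpa only [Function.comp_def, he] using h1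
    · rw [← (Fin.consEquiv fun _ => ι).hasSum_iff, pow_succ']
      simpa only [Function.comp_def, he] using h2

/-- The exponential series, each power expanded over tuples; absolute convergence permits summing
over all tuple lengths at once. -/
lemma hasSum_fock {f : ι → ℝ} (hf : Summable fun i => ‖f i‖) :
    HasSum (fun p : Σ n, (Fin n → ι) => (p.1.factorial : ℝ)⁻¹ * ∏ j, f (p.2 j))
      (Real.exp (∑' i, f i)) := by
  have hs : ∀ {g : ι → ℝ}, (Summable fun i => ‖g i‖) → ∀ n, HasSum
      (fun i : Fin n → ι => (n.factorial : ℝ)⁻¹ * ∏ j, g (i j))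
      ((n.factorial : ℝ)⁻¹ * (∑' i, g i) ^ n) := fun hg n =>
    (summable_and_hasSum_pi_prod hg n).2.mul_left _
  have he : ∀ x : ℝ, HasSum (fun n : ℕ => (n.factorial : ℝ)⁻¹ * x ^ n) (Real.exp x) := fun x => by
    have := NormedSpace.expSeries_div_hasSum_exp (𝔸 := ℝ) x
    rw [← Real.exp_eq_exp_ℝ] at this
    simpa only [div_eq_inv_mul] using this
  refine HasSum.sigma_of_hasSum (he _) (hs hf) ?_
  have hf' : Summable fun i => ‖‖f i‖‖ := by simpa using hf
  have h2 : Summable fun p : Σ n, (Fin n → ι) =>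
      (p.1.factorial : ℝ)⁻¹ * ∏ j, ‖f (p.2 j)‖ := by
    rw [summable_sigma_of_nonneg fun p =>
      mul_nonneg (by positivity) (Finset.prod_nonneg fun _ _ => norm_nonneg _)]
    refine ⟨fun n => (hs hf' n).summable, ?_⟩
    simp_rw [fun n => (hs hf' n).tsum_eq]
    exact (he _).summable
  refine Summable.of_norm (h2.congr fun p => ?_)
  rw [norm_mul, Finset.prod_congr rfl fun _ _ => rfl, norm_prod, Real.norm_of_nonneg]
  positivity

variable {H : Type*} [NormedAddCommGroup H] [InnerProductSpace ℝ H]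

lemma hasSum_fock_basis (b : HilbertBasis ι ℝ H) (g k : H) :
    HasSum (fun p : Σ n, (Fin n → ι) => (p.1.factorial : ℝ)⁻¹ *
      ∏ j, (⟪g, b (p.2 j)⟫_ℝ * ⟪b (p.2 j), k⟫_ℝ)) (Real.exp ⟪g, k⟫_ℝ) := by
  rw [← b.tsum_inner_mul_inner g k]
  exact hasSum_fock (f := fun i => ⟪g, b i⟫_ℝ * ⟪b i, k⟫_ℝ) (b.summable_inner_mul_inner g k).norm

/-- The coordinates of the exponential vector `∑ g^{⊗ n} / √n!`. -/
noncomputable def expCoord (b : HilbertBasis ι ℝ H) (g : H) (p : Σ n, (Fin n → ι)) : ℝ :=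
  (√(p.1.factorial : ℝ))⁻¹ * ∏ j, ⟪b (p.2 j), g⟫_ℝ

lemma expCoord_mul (b : HilbertBasis ι ℝ H) (g k : H) (p : Σ n, (Fin n → ι)) :
    expCoord b g p * expCoord b k p = (p.1.factorial : ℝ)⁻¹ *
      ∏ j, (⟪g, b (p.2 j)⟫_ℝ * ⟪b (p.2 j), k⟫_ℝ) := by
  rw [expCoord, expCoord, mul_mul_mul_comm, ← mul_inv, Real.mul_self_sqrt (by positivity),
    ← Finset.prod_mul_distrib]
  simp only [real_inner_comm]

/-- The exponential vector of `g` in Fock space. -/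
noncomputable def expVec (b : HilbertBasis ι ℝ H) (g : H) :
    lp (fun _ : Σ n, (Fin n → ι) => ℝ) 2 :=
  ⟨expCoord b g, by
    refine memℓp_gen ?_
    have h := (hasSum_fock_basis b g g).summable
    simp only [← expCoord_mul] at h
    refine h.congr fun p => ?_
    simp [sq]⟩

lemma inner_expVec (b : HilbertBasis ι ℝ H) (g k : H) :
    ⟪expVec b g, expVec b k⟫_ℝ = Real.exp ⟪g, k⟫_ℝ := by
  refine (lp.hasSum_inner (𝕜 := ℝ) (expVec b g) (expVec b k)).unique ?_
  refine (hasSum_fock_basis b g k).congr_fun ?_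
  intro p
  rw [← expCoord_mul, mul_comm]
  rfl

/-- The vectors F h have the same Gram matrix as the exponential vectors of P h, so X embeds
isometrically in Fock space. There R becomes diagonal with entries ∏ l (i j), as ⟪b i, T g⟫ = l i ⟪b
i, g⟫. -/
theorem isCompactOperator_secondQuantization [CompleteSpace H] {X : Type*}
    [NormedAddCommGroup X] [InnerProductSpace ℝ X] [CompleteSpace X]
    (F : H → X) (P A T : H →L[ℝ] H) (R : X →L[ℝ] X)
    (hdense : Dense (Submodule.span ℝ (range F) : Set X))
    (hF : ∀ h k, ⟪F h, F k⟫_ℝ = Real.exp ⟪P h, P k⟫_ℝ)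
    (hR : ∀ h, R (F h) = F (A h)) (hT : ∀ h, T (P h) = P (A h)) (b : HilbertBasis ι ℝ H)
    (l : ι → ℝ) (hs : T.IsSymmetric) (hl : ∀ i, T (b i) = l i • b i) {q : ℝ} (hq0 : 0 ≤ q)
    (hq : q < 1) (hlq : ∀ i, |l i| ≤ q) (hfin : ∀ ε > 0, {i | ε ≤ |l i|}.Finite) :
    IsCompactOperator R := by
  obtain ⟨J, hJ, hJJ⟩ := exists_isometry_of_gram F (fun h => expVec b (P h))
    (fun h k => by rw [inner_expVec, hF]) hdense
  let d : (Σ n, (Fin n → ι)) → ℝ := fun p => ∏ j, l (p.2 j)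
  have hdq : ∀ p, |d p| ≤ q ^ p.1 := fun p => by
    rw [Finset.abs_prod]
    refine (Finset.prod_le_prod (fun _ _ => abs_nonneg _) fun j _ => hlq (p.2 j)).trans ?_
    simp
  have hd : ∀ p, |d p| ≤ 1 := fun p => (hdq p).trans (pow_le_one₀ hq0 hq.le)
  have hcomp : IsCompactOperator (diagOp d 1 hd) := by
    refine isCompactOperator_diagOp hd fun ε hε => ?_
    obtain ⟨N, hN⟩ := exists_pow_lt_of_lt_one hε hq
    have hfi := hfin ε hε
    -- An entry of modulus at least ε comes from a tuple of length below N, since q ^ N < ε, all of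
    -- whose eigenvalues have modulus at least ε.
    refine ((finite_Iio N).biUnion fun n _ => (Finite.pi (ι := Fin n) fun _ => hfi).image
      (Sigma.mk (β := fun n => Fin n → ι) n)).subset ?_
    rintro ⟨n, i⟩ hp
    have hp : ε ≤ |d ⟨n, i⟩| := hp
    refine mem_biUnion (x := n) ?_ ⟨i, fun j _ => ?_, rfl⟩
    · by_contra hn
      rw [mem_Iio, not_lt] at hn
      exact absurd (hp.trans (hdq _)) (not_le.2
        ((pow_le_pow_of_le_one hq0 hq.le hn).trans_lt hN))
    · refine hp.trans ?_
      simp only [d]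
      rw [← Finset.mul_prod_erase _ _ (Finset.mem_univ j), abs_mul, Finset.abs_prod]
      exact mul_le_of_le_one_right (abs_nonneg _) (Finset.prod_le_one (fun _ _ => abs_nonneg _)
        fun k _ => (hlq _).trans hq.le)
  have hDe : ∀ g, diagOp d 1 hd (expVec b g) = expVec b (T g) := fun g => by
    ext p
    rw [diagOp_apply]
    change d p * ((√(p.1.factorial : ℝ))⁻¹ * ∏ j, ⟪b (p.2 j), g⟫_ℝ) =
      (√(p.1.factorial : ℝ))⁻¹ * ∏ j, ⟪b (p.2 j), T g⟫_ℝ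
    have : ∀ i, ⟪b i, T g⟫_ℝ = l i * ⟪b i, g⟫_ℝ := fun i => by
      rw [← real_inner_smul_left, ← hl]; exact (hs _ _).symm
    simp only [this, Finset.prod_mul_distrib, d]
    ring
  have hRJ : R = J.adjoint ∘L diagOp d 1 hd ∘L J := by
    refine ContinuousLinearMap.ext_on hdense ?_
    rintro _ ⟨h, rfl⟩
    have := DFunLike.congr_fun hJJ (F (A h))
    simp only [ContinuousLinearMap.comp_apply, ContinuousLinearMap.id_apply] at this
    rw [hR, ContinuousLinearMap.comp_apply, ContinuousLinearMap.comp_apply, hJ, hDe, hT, ← hJ,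
      this]
  rw [hRJ]
  exact (hcomp.comp_clm J).clm_comp J.adjoint

end Fock

end OrnsteinUhlenbeck

namespace OrnsteinUhlenbeck

/-! ### Strongly continuous semigroups -/

namespace IsC0Semigroup

open Filter Topology

section Banach

variable {E : Type*} [NormedAddCommGroup E] [NormedSpace ℝ E] [CompleteSpace E]
  {S : ℝ≥0 → E →L[ℝ] E}

lemma add_apply (hS : IsC0Semigroup S) (s t : ℝ≥0) (x : E) : S (s + t) x = S s (S t x) := by
  rw [hS.map_add]; rfl

lemma zero_apply (hS : IsC0Semigroup S) (x : E) : S 0 x = x := by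
  rw [hS.map_zero]; rfl

lemma exists_norm_le (hS : IsC0Semigroup S) (K : ℝ≥0) : ∃ M : ℝ, 0 ≤ M ∧ ∀ s ≤ K, ‖S s‖ ≤ M := by
  have h : ∀ x : E, ∃ C, ∀ s : Icc (0 : ℝ≥0) K, ‖S s x‖ ≤ C := fun x => by
    obtain ⟨C, hC⟩ := (isCompact_Icc (a := (0 : ℝ≥0)) (b := K)).exists_bound_of_continuousOn
      (hS.continuous_orbit x).continuousOn
    exact ⟨C, fun s => hC s s.2⟩
  obtain ⟨M, hM⟩ := banach_steinhaus h
  exact ⟨M, (norm_nonneg _).trans (hM ⟨0, by simp⟩), fun s hs => hM ⟨s, zero_le, hs⟩⟩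

/-- A semigroup which is locally bounded and continuous at zero is strongly continuous. -/
lemma of_tendsto_zero {T : ℝ≥0 → E →L[ℝ] E} (h0 : T 0 = ContinuousLinearMap.id ℝ E)
    (hadd : ∀ s t, T (s + t) = T s ∘L T t)
    (hb : ∀ K : ℝ≥0, ∃ M : ℝ, ∀ s ≤ K, ‖T s‖ ≤ M)
    (hlim : ∀ x, Tendsto (fun t => T t x) (𝓝 0) (𝓝 x)) : IsC0Semigroup T := by
  refine ⟨h0, hadd, fun x => continuous_iff_continuousAt.2 fun s => ?_⟩
  obtain ⟨M, hM⟩ := hb (s + 1)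
  -- Factoring out the smaller time reduces left and right continuity alike to continuity at 0; only
  -- the smaller time needs a norm bound.
  have key : ∀ a b : ℝ≥0, a ≤ b → a ≤ s + 1 →
      ‖T a x - T b x‖ ≤ M * ‖T (nndist a b) x - x‖ := by
    intro a b hab ha
    have hd : nndist a b = b - a := by
      rw [← NNReal.coe_inj, coe_nndist, NNReal.dist_eq, NNReal.coe_sub hab, abs_sub_comm,
        abs_of_nonneg (sub_nonneg.2 (NNReal.coe_le_coe.2 hab))]
    have hba : b = a + (b - a) := (add_tsub_cancel_of_le hab).symm
    rw [hd]
    conv_lhs => rw [hba, hadd, ContinuousLinearMap.comp_apply, ← map_sub]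
    rw [norm_sub_rev _ x]
    exact ((T a).le_opNorm _).trans (mul_le_mul_of_nonneg_right (hM a ha) (norm_nonneg _))
  have hev : ∀ᶠ t in 𝓝 s, ‖T t x - T s x‖ ≤ M * ‖T (nndist t s) x - x‖ := by
    filter_upwards [Iio_mem_nhds (show s < s + 1 from lt_add_one s)] with t ht
    rcases le_total t s with h | h
    · exact key t s h ht.le
    · rw [norm_sub_rev, nndist_comm]
      exact key s t h (lt_add_one s).le
  have h2 : Tendsto (fun t => M * ‖T (nndist t s) x - x‖) (𝓝 s) (𝓝 0) := by
    have h3 : Tendsto (fun t : ℝ≥0 => nndist t s) (𝓝 s) (𝓝 0) := by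
      have : Continuous fun t : ℝ≥0 => nndist t s := by fun_prop
      simpa using this.tendsto s
    have := ((((hlim x).comp h3).sub_const x).norm).const_mul M
    simpa using this
  rw [ContinuousAt, tendsto_iff_norm_sub_tendsto_zero]
  exact squeeze_zero' (Eventually.of_forall fun _ => norm_nonneg _) hev h2

/-- Operators uniformly bounded near time 0 are equicontinuous, so convergence survives limits of
vectors. -/
lemma isClosed_tendsto_zero {T : ℝ≥0 → E →L[ℝ] E} {M : ℝ} (hM : ∀ᶠ t in 𝓝 0, ‖T t‖ ≤ M) :
    IsClosed {x | Tendsto (fun t => T t x) (𝓝 0) (𝓝 x)} := by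
  have hM0 : 0 ≤ M := by
    obtain ⟨t, ht⟩ := hM.exists
    exact (norm_nonneg _).trans ht
  refine isClosed_of_closure_subset fun x hx => ?_
  change Tendsto (fun t => T t x) (𝓝 0) (𝓝 x)
  rw [Metric.tendsto_nhds]
  intro ε hε
  obtain ⟨y, hy, hxy⟩ := Metric.mem_closure_iff.1 hx (ε / (2 * (M + 1))) (by positivity)
  rw [dist_eq_norm, lt_div_iff₀ (by positivity)] at hxy
  filter_upwards [Metric.tendsto_nhds.1 hy (ε / 2) (half_pos hε), hM] with t ht ht1
  rw [dist_eq_norm] at ht ⊢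
  have h1 : ‖T t (x - y)‖ ≤ M * ‖x - y‖ :=
    ((T t).le_opNorm _).trans (mul_le_mul_of_nonneg_right ht1 (norm_nonneg _))
  calc ‖T t x - x‖ = ‖T t (x - y) + (T t y - y) + (y - x)‖ := by
        rw [map_sub]; congr 1; abel
    _ ≤ ‖T t (x - y)‖ + ‖T t y - y‖ + ‖y - x‖ := norm_add₃_le
    _ < ε := by rw [norm_sub_rev y x]; nlinarith

lemma continuous_apply (hS : IsC0Semigroup S) {f : ℝ≥0 → E} (hf : Continuous f) :
    Continuous fun s => S s (f s) := by
  refine continuous_iff_continuousAt.2 fun s => ?_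
  obtain ⟨M, -, hM⟩ := hS.exists_norm_le (s + 1)
  rw [ContinuousAt, tendsto_iff_norm_sub_tendsto_zero]
  have h1 : Tendsto (fun t => M * ‖f t - f s‖ + ‖S t (f s) - S s (f s)‖) (𝓝 s) (𝓝 0) := by
    have h1 := (((hf.tendsto s).sub_const (f s)).norm).const_mul M
    have h2 := (((hS.continuous_orbit (f s)).tendsto s).sub_const (S s (f s))).norm
    simpa using h1.add h2
  refine squeeze_zero' (Eventually.of_forall fun _ => norm_nonneg _) ?_ h1
  filter_upwards [Iio_mem_nhds (show s < s + 1 from lt_add_one s)] with t ht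
  calc ‖S t (f t) - S s (f s)‖ = ‖S t (f t - f s) + (S t (f s) - S s (f s))‖ := by
        rw [map_sub]; congr 1; abel
    _ ≤ ‖S t (f t - f s)‖ + ‖S t (f s) - S s (f s)‖ := norm_add_le _ _
    _ ≤ _ := by
        gcongr
        exact ((S t).le_opNorm _).trans
          (mul_le_mul_of_nonneg_right (hM t ht.le) (norm_nonneg _))

lemma continuous_orbit_toNNReal (hS : IsC0Semigroup S) (x : E) :
    Continuous fun s : ℝ => S s.toNNReal x :=
  (hS.continuous_orbit x).comp continuous_real_toNNReal

/-- The operators `x ↦ ∫₀^ε S(s) x ds`. -/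
lemma exists_integralOp (hS : IsC0Semigroup S) (ε : ℝ≥0) :
    ∃ B : E →L[ℝ] E, ∀ x, B x = ∫ s in (0 : ℝ)..ε, S s.toNNReal x := by
  obtain ⟨M, hM0, hM⟩ := hS.exists_norm_le ε
  have hi : ∀ x, IntervalIntegrable (fun s : ℝ => S s.toNNReal x) volume 0 ε := fun x =>
    (hS.continuous_orbit_toNNReal x).intervalIntegrable _ _
  refine ⟨LinearMap.mkContinuous
    { toFun := fun x => ∫ s in (0 : ℝ)..ε, S s.toNNReal x
      map_add' := fun x y => by
        rw [← intervalIntegral.integral_add (hi x) (hi y)]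
        exact intervalIntegral.integral_congr fun s _ => _root_.map_add _ x y
      map_smul' := fun a x => by
        rw [RingHom.id_apply, ← intervalIntegral.integral_smul]
        exact intervalIntegral.integral_congr fun s _ => map_smul _ a x } (M * ε) ?_,
    fun x => rfl⟩
  intro x
  have := intervalIntegral.norm_integral_le_of_norm_le_const (a := (0 : ℝ)) (b := ε)
    (f := fun s : ℝ => S s.toNNReal x) (C := M * ‖x‖) fun s hs => by
      rw [uIoc_of_le ε.coe_nonneg] at hs
      refine ((S s.toNNReal).le_opNorm x).trans
        (mul_le_mul_of_nonneg_right (hM _ ?_) (norm_nonneg _))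
      exact Real.toNNReal_le_iff_le_coe.2 hs.2
  refine this.trans_eq ?_
  rw [sub_zero, abs_of_nonneg ε.coe_nonneg]
  ring

end Banach

section Hilbert

variable {H : Type*} [NormedAddCommGroup H] [InnerProductSpace ℝ H] [CompleteSpace H]
  {S : ℝ≥0 → H →L[ℝ] H}

/-- The adjoint of a strongly continuous semigroup on a Hilbert space is strongly continuous. -/
theorem adjoint (hS : IsC0Semigroup S) : IsC0Semigroup fun t => (S t).adjoint := by
  have hb : ∀ K : ℝ≥0, ∃ M : ℝ, 0 ≤ M ∧ ∀ s ≤ K, ‖(S s).adjoint‖ ≤ M := fun K => by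
    obtain ⟨M, hM0, hM⟩ := hS.exists_norm_le K
    exact ⟨M, hM0, fun s hs => by rw [LinearIsometryEquiv.norm_map]; exact hM s hs⟩
  obtain ⟨M, hM0, hM⟩ := hb 1
  refine of_tendsto_zero ?_ ?_ (fun K => (hb K).imp fun _ h => h.2) ?_
  · rw [hS.map_zero, ContinuousLinearMap.adjoint_id]
  · intro s t
    rw [add_comm, hS.map_add, ContinuousLinearMap.adjoint_comp]
  -- the vectors where the orbit is continuous at zero form a closed subspace
  let D : Submodule ℝ H :=
    { carrier := {x | Tendsto (fun t => (S t).adjoint x) (𝓝 0) (𝓝 x)}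
      add_mem' := fun {x y} hx hy => by
        have h : Tendsto (fun t => (S t).adjoint x + (S t).adjoint y) (𝓝 0) (𝓝 (x + y)) :=
          hx.add hy
        exact h.congr fun t => (_root_.map_add _ x y).symm
      zero_mem' := by simp
      smul_mem' := fun c x hx => by
        have h : Tendsto (fun t => c • (S t).adjoint x) (𝓝 0) (𝓝 (c • x)) := hx.const_smul c
        exact h.congr fun t => (map_smul _ c x).symm }
  have hD : IsClosed (D : Set H) := isClosed_tendsto_zero (M := M) <| by
    filter_upwards [Iio_mem_nhds (show (0 : ℝ≥0) < 1 from zero_lt_one)] with t ht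
    exact hM t (le_of_lt ht)
  suffices D = ⊤ by
    intro x
    have : x ∈ D := this ▸ Submodule.mem_top
    exact this
  rw [← hD.submodule_topologicalClosure_eq, Submodule.topologicalClosure_eq_top_iff, eq_bot_iff]
  intro y hy
  -- Density of D is tested by y orthogonal to the ranges of the B ε*. Then B ε y = 0 for all ε, and
  -- the derivative of ∫₀^ε S(s) y ds at ε = 0 gives y = 0.
  choose B hB using fun ε : ℝ≥0 => hS.exists_integralOp ε
  have hmem : ∀ (ε : ℝ≥0) (x : H), (B ε).adjoint x ∈ D := by
    intro ε x
    obtain ⟨K, hK0, hK⟩ := hS.exists_norm_le (ε + 1)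
    -- B ε (S t - 1) is a difference of integrals over two intervals of length t. The point is an
    -- estimate in operator norm, which passes to the adjoint.
    have hbd : ∀ t : ℝ≥0, t ≤ 1 → ‖(B ε) ∘L (S t - 1)‖ ≤ 2 * K * t := by
      intro t ht
      refine ContinuousLinearMap.opNorm_le_bound _ (by positivity) fun z => ?_
      have hci : ∀ a b : ℝ, IntervalIntegrable (fun s : ℝ => S s.toNNReal z) volume a b :=
        fun a b => (hS.continuous_orbit_toNNReal z).intervalIntegrable _ _
      have h1 : B ε (S t z) = ∫ s in (t : ℝ)..(ε + t), S s.toNNReal z := by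
        rw [hB]
        have h2 := intervalIntegral.integral_comp_add_right (a := (0 : ℝ)) (b := ε)
          (fun s : ℝ => S s.toNNReal z) (t : ℝ)
        rw [zero_add] at h2
        rw [← h2]
        refine intervalIntegral.integral_congr fun s hs => ?_
        rw [uIcc_of_le ε.coe_nonneg] at hs
        rw [Real.toNNReal_add hs.1 t.coe_nonneg, hS.add_apply, Real.toNNReal_coe]
      have h2 : (B ε) (S t z) - B ε z = (∫ s in (ε : ℝ)..(ε + t), S s.toNNReal z)
          - ∫ s in (0 : ℝ)..t, S s.toNNReal z := by
        rw [h1, hB, intervalIntegral.integral_interval_sub_interval_comm' (hci _ _) (hci _ _)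
          (hci _ _)]
      have hest : ∀ a b : ℝ, 0 ≤ a → a ≤ b → b ≤ ε + 1 →
          ‖∫ s in a..b, S s.toNNReal z‖ ≤ K * ‖z‖ * (b - a) := by
        intro a b ha hab hbe
        have := intervalIntegral.norm_integral_le_of_norm_le_const (a := a) (b := b)
          (f := fun s : ℝ => S s.toNNReal z) (C := K * ‖z‖) fun s hs => by
            rw [uIoc_of_le hab] at hs
            refine ((S s.toNNReal).le_opNorm z).trans
              (mul_le_mul_of_nonneg_right (hK _ ?_) (norm_nonneg _))
            refine Real.toNNReal_le_iff_le_coe.2 (hs.2.trans ?_)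
            push_cast; exact hbe
        rwa [abs_of_nonneg (sub_nonneg.2 hab)] at this
      have ht' : (t : ℝ) ≤ 1 := by exact_mod_cast ht
      have e1 := hest ε (ε + t) ε.coe_nonneg (by simp) (by linarith)
      have e2 := hest 0 t le_rfl t.coe_nonneg (by linarith [ε.coe_nonneg, ht'])
      rw [ContinuousLinearMap.comp_apply, sub_apply, map_sub, one_apply_eq_self, h2]
      refine (norm_sub_le _ _).trans ((add_le_add e1 e2).trans_eq ?_)
      ring
    have hadj : ∀ t : ℝ≥0, t ≤ 1 →
        ‖(S t).adjoint ((B ε).adjoint x) - (B ε).adjoint x‖ ≤ 2 * K * t * ‖x‖ := by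
      intro t ht
      have : (S t).adjoint ((B ε).adjoint x) - (B ε).adjoint x
          = ((B ε) ∘L (S t - 1)).adjoint x := by
        rw [ContinuousLinearMap.adjoint_comp, map_sub]
        simp [ContinuousLinearMap.one_def, ContinuousLinearMap.adjoint_id]
      rw [this]
      refine (ContinuousLinearMap.le_opNorm _ _).trans
        (mul_le_mul_of_nonneg_right ?_ (norm_nonneg _))
      rw [LinearIsometryEquiv.norm_map]
      exact hbd t ht
    change Tendsto (fun t => (S t).adjoint ((B ε).adjoint x)) (𝓝 0) (𝓝 ((B ε).adjoint x))
    rw [tendsto_iff_norm_sub_tendsto_zero]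
    refine squeeze_zero' (g := fun t : ℝ≥0 => 2 * K * t * ‖x‖)
      (Eventually.of_forall fun _ => norm_nonneg _) ?_ ?_
    · filter_upwards [Iio_mem_nhds (show (0 : ℝ≥0) < 1 from zero_lt_one)] with t ht
      exact hadj t (le_of_lt ht)
    · have : Continuous fun t : ℝ≥0 => 2 * K * (t : ℝ) * ‖x‖ := by fun_prop
      simpa using this.tendsto 0
  have hBy : ∀ ε, B ε y = 0 := fun ε => by
    rw [← inner_self_eq_zero (𝕜 := ℝ), ← ContinuousLinearMap.adjoint_inner_left]
    exact hy _ (hmem ε _)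
  have hder : HasDerivAt (fun u : ℝ => ∫ s in (0 : ℝ)..u, S s.toNNReal y)
      (S (0 : ℝ).toNNReal y) 0 :=
    intervalIntegral.integral_hasDerivAt_right
      ((hS.continuous_orbit_toNNReal y).intervalIntegrable _ _)
      ((hS.continuous_orbit_toNNReal y).stronglyMeasurableAtFilter _ _)
      (hS.continuous_orbit_toNNReal y).continuousAt
  have hlim := hder.tendsto_slope_zero_right
  rw [Real.toNNReal_zero, hS.zero_apply] at hlim
  refine tendsto_nhds_unique hlim (tendsto_const_nhds.congr' ?_)
  filter_upwards [self_mem_nhdsWithin] with t ht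
  have : (∫ s in (0 : ℝ)..t, S s.toNNReal y) = 0 := by
    have := hBy t.toNNReal
    rwa [hB, Real.coe_toNNReal _ (le_of_lt (mem_Ioi.1 ht))] at this
  simp [this]

end Hilbert

end IsC0Semigroup

end OrnsteinUhlenbeck

namespace OrnsteinUhlenbeck

/-! ### Existence of Gaussian measures on Hilbert spaces -/

section Gaussian

open ProbabilityTheory Filter Topology

/-- Orthogonal vectors with square summable norms are summable. -/
lemma summable_of_orthogonal {X ι : Type*} [NormedAddCommGroup X] [InnerProductSpace ℝ X]
    [CompleteSpace X] {v : ι → X} (ho : ∀ i j, i ≠ j → ⟪v i, v j⟫_ℝ = 0)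
    (hs : Summable fun i => ‖v i‖ ^ 2) : Summable v := by
  have hV : OrthogonalFamily ℝ (fun i => Submodule.span ℝ {v i})
      fun i => (Submodule.span ℝ {v i}).subtypeₗᵢ := by
    intro i j hij x y
    obtain ⟨a, ha⟩ := Submodule.mem_span_singleton.1 x.2
    obtain ⟨c, hc⟩ := Submodule.mem_span_singleton.1 y.2
    change ⟪(x : X), (y : X)⟫_ℝ = 0
    rw [← ha, ← hc, real_inner_smul_left, real_inner_smul_right, ho i j hij, mul_zero, mul_zero]
  exact (hV.summable_iff_norm_sq_summable
    (fun i => ⟨v i, Submodule.mem_span_singleton_self _⟩)).2 hs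

variable {H : Type*} [NormedAddCommGroup H] [InnerProductSpace ℝ H]
  [TopologicalSpace.SeparableSpace H] [MeasurableSpace H] [BorelSpace H]

/-- Since r ↦ exp(i r) is 1-Lipschitz, characteristic functionals are continuous under L²
convergence of random vectors. -/
lemma norm_integral_cexp_inner_sub_le {Ω : Type*} [MeasurableSpace Ω] (P : Measure Ω)
    [IsProbabilityMeasure P] (X Y : Lp H 2 P) (h : H) :
    ‖(∫ ω, Complex.exp ((⟪X ω, h⟫_ℝ : ℂ) * Complex.I) ∂P) -
      ∫ ω, Complex.exp ((⟪Y ω, h⟫_ℝ : ℂ) * Complex.I) ∂P‖ ≤ ‖X - Y‖ * ‖h‖ := by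
  have hint : ∀ Z : Lp H 2 P,
      Integrable (fun ω => Complex.exp ((⟪Z ω, h⟫_ℝ : ℂ) * Complex.I)) P := fun Z => by
    refine Integrable.of_bound (C := 1) ?_ (Eventually.of_forall fun ω => ?_)
    · have := (Lp.aestronglyMeasurable Z)
      refine (Continuous.comp_aestronglyMeasurable (g := fun x : H =>
        Complex.exp ((⟪x, h⟫_ℝ : ℂ) * Complex.I)) (by fun_prop) this)
    · rw [Complex.norm_exp_ofReal_mul_I]
  rw [← integral_sub (hint X) (hint Y)]
  have hXY : Integrable (fun ω => ‖(X - Y) ω‖ * ‖h‖) P :=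
    ((Lp.memLp (X - Y)).integrable (by norm_num)).norm.mul_const _
  refine (norm_integral_le_of_norm_le hXY ?_).trans ?_
  · filter_upwards [Lp.coeFn_sub X Y] with ω hω
    rw [hω, Pi.sub_apply]
    have h1 : Complex.exp ((⟪X ω, h⟫_ℝ : ℂ) * Complex.I) =
        Complex.exp ((⟪Y ω, h⟫_ℝ : ℂ) * Complex.I) *
          Complex.exp (Complex.I * ((⟪X ω - Y ω, h⟫_ℝ : ℝ) : ℂ)) := by
      rw [← Complex.exp_add, inner_sub_left]; congr 1; push_cast; ring
    rw [h1, ← mul_sub_one, norm_mul, Complex.norm_exp_ofReal_mul_I, one_mul]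
    exact Real.norm_exp_I_mul_ofReal_sub_one_le.trans (abs_real_inner_le_norm _ _)
  · rw [integral_mul_const]
    refine mul_le_mul_of_nonneg_right ?_ (norm_nonneg _)
    have h2 : ‖X - Y‖ = (eLpNorm (X - Y) 2 P).toReal := Lp.norm_def _
    rw [h2, integral_norm_eq_lintegral_enorm (Lp.aestronglyMeasurable _),
      ← eLpNorm_one_eq_lintegral_enorm]
    exact ENNReal.toReal_mono (Lp.eLpNorm_ne_top _)
      (eLpNorm_le_eLpNorm_of_exponent_le (by norm_num) (Lp.aestronglyMeasurable _))

/-- The measure is the law of ∑ ξ_i C^{1/2} b_i with independent standard normal ξ_i. The terms are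
orthogonal in L², and the sum of their squared norms is a multiple of the trace of C, so the series
converges there. -/
theorem exists_isCenteredGaussian [CompleteSpace H] {C : H →L[ℝ] H} (hC : C.IsPositive)
    {ι : Type*} (b : HilbertBasis ι ℝ H) (hsum : Summable fun i => ⟪C (b i), b i⟫_ℝ) :
    ∃ μ : Measure H, IsCenteredGaussian C μ := by
  classical
  have : SecondCountableTopology H := UniformSpace.secondCountable_of_separable H
  obtain ⟨hB, hBB⟩ := posSqrt_spec hC
  set B := posSqrt C
  let P : Measure (ι → ℝ) := Measure.infinitePi fun _ => gaussianReal 0 1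
  have hmp : ∀ i, MeasurePreserving (Function.eval i) P (gaussianReal 0 1) := fun i =>
    measurePreserving_eval_infinitePi _ i
  have hmem : ∀ i, MemLp (fun ω : ι → ℝ => ω i) 2 P := fun i =>
    (memLp_id_gaussianReal (μ := 0) (v := 1) 2).comp_measurePreserving (hmp i)
  have hmem' : ∀ i, MemLp (fun ω : ι → ℝ => ω i • B (b i)) 2 P := fun i =>
    ((ContinuousLinearMap.toSpanSingleton ℝ (B (b i))).comp_memLp' (hmem i))
  let v : ι → Lp H 2 P := fun i => (hmem' i).toLp _
  have hinner : ∀ i j, ⟪v i, v j⟫_ℝ = (∫ ω, ω i * ω j ∂P) * ⟪B (b i), B (b j)⟫_ℝ := by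
    intro i j
    rw [L2.inner_def, ← integral_mul_const]
    refine integral_congr_ae ?_
    filter_upwards [(hmem' i).coeFn_toLp, (hmem' j).coeFn_toLp] with ω h1 h2
    simp only [v, h1, h2, real_inner_smul_left, real_inner_smul_right]
    ring
  have hind : iIndepFun (fun i (ω : ι → ℝ) => ω i) P :=
    iIndepFun_infinitePi (X := fun _ x => x) fun _ => measurable_id
  have hmean : ∀ i, ∫ ω, ω i ∂P = 0 := fun i => by
    have h := (hmp i).map_eq
    have h2 : ∫ x, x ∂(P.map (Function.eval i)) = ∫ ω, ω i ∂P :=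
      integral_map (hmp i).measurable.aemeasurable (by fun_prop)
    rw [← h2, h, integral_id_gaussianReal]
  have hsq : ∀ i, ∫ ω, ω i * ω i ∂P = ∫ x, x * x ∂(gaussianReal 0 1) := fun i => by
    have h := (hmp i).map_eq
    rw [← h]
    exact (integral_map (f := fun x : ℝ => x * x) (hmp i).measurable.aemeasurable
      (by fun_prop)).symm
  have hvs : Summable v := by
    refine summable_of_orthogonal (fun i j hij => ?_) ?_
    · rw [hinner, (hind.indepFun hij).integral_fun_mul_eq_mul_integral
        (hmem i).aestronglyMeasurable (hmem j).aestronglyMeasurable, hmean, zero_mul, zero_mul]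
    · have : ∀ i, ‖v i‖ ^ 2 = (∫ x, x * x ∂(gaussianReal 0 1)) * ⟪C (b i), b i⟫_ℝ := fun i => by
        rw [← real_inner_self_eq_norm_sq, hinner, hsq, inner_posSqrt hC]
      simp_rw [this]
      exact hsum.mul_left _
  set X := ∑' i, v i with hX
  have hXm : AEMeasurable X P := (Lp.aestronglyMeasurable X).aemeasurable
  refine ⟨P.map X, Measure.isProbabilityMeasure_map hXm, fun h => ?_⟩
  have hchar : charFun (P.map X) h =
      ∫ ω, Complex.exp ((⟪X ω, h⟫_ℝ : ℂ) * Complex.I) ∂P := by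
    rw [charFun_apply, integral_map hXm (by fun_prop)]
  -- By independence the characteristic functional of a partial sum is a product of one-dimensional
  -- Gaussian ones.
  have hfin : ∀ s : Finset ι, ∫ ω, Complex.exp ((⟪(∑ i ∈ s, v i : Lp H 2 P) ω, h⟫_ℝ : ℂ) *
      Complex.I) ∂P = ∏ i ∈ s, Complex.exp (-((⟪B h, b i⟫_ℝ * ⟪b i, B h⟫_ℝ : ℝ) : ℂ) / 2) := by
    intro s
    have h1 : iIndepFun (fun i (ω : ι → ℝ) => ω i • B (b i)) P :=
      iIndepFun_infinitePi (X := fun i x => x • B (b i)) fun _ => by fun_prop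
    have hmeas : ∀ i, Measurable fun ω : ι → ℝ => ω i • B (b i) := fun i => by fun_prop
    have h2 := congrFun ((h1.restrict s).charFun_map_fun_finsetSum_eq_prod
      fun i _ => (hmeas i).aemeasurable) h
    rw [charFun_apply, integral_map (Finset.measurable_sum s fun i _ => hmeas i).aemeasurable
      (by fun_prop), Finset.prod_apply] at h2
    have h3 : ∫ ω, Complex.exp ((⟪(∑ i ∈ s, v i : Lp H 2 P) ω, h⟫_ℝ : ℂ) * Complex.I) ∂P
        = ∫ ω, Complex.exp ((⟪∑ i ∈ s, ω i • B (b i), h⟫_ℝ : ℂ) * Complex.I) ∂P := by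
      refine integral_congr_ae ?_
      have hall : ∀ᵐ ω ∂P, ∀ i ∈ s, v i ω = ω i • B (b i) :=
        (Finset.eventually_all s).2 fun i _ => (hmem' i).coeFn_toLp
      filter_upwards [Lp.coeFn_finsetSum s v, hall] with ω h4 h5
      rw [h4, Finset.sum_apply, Finset.sum_congr rfl h5]
    rw [h3, h2]
    refine Finset.prod_congr rfl fun i _ => ?_
    rw [charFun_apply, integral_map (hmeas i).aemeasurable (by fun_prop)]
    have h6 := charFun_gaussianReal (μ := 0) (v := 1) ⟪B (b i), h⟫_ℝ
    rw [← (hmp i).map_eq, charFun_apply, integral_map (hmp i).measurable.aemeasurable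
      (by fun_prop)] at h6
    have h7 : ⟪B (b i), h⟫_ℝ = ⟪b i, B h⟫_ℝ := hB.inner_left_eq_inner_right _ _
    convert h6 using 2
    · ext ω
      simp [real_inner_smul_left, mul_comm]
    · rw [h7, real_inner_comm (b i)]
      push_cast
      ring
  have hlim1 : Tendsto (fun s : Finset ι => ∫ ω, Complex.exp
      ((⟪(∑ i ∈ s, v i : Lp H 2 P) ω, h⟫_ℝ : ℂ) * Complex.I) ∂P) atTop
      (𝓝 (charFun (P.map X) h)) := by
    rw [hchar, tendsto_iff_norm_sub_tendsto_zero]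
    refine squeeze_zero (fun _ => norm_nonneg _)
      (fun s => norm_integral_cexp_inner_sub_le P _ X h) ?_
    have := (tendsto_iff_norm_sub_tendsto_zero.1 hvs.hasSum).mul_const ‖h‖
    simpa using this
  refine tendsto_nhds_unique hlim1 ?_
  simp_rw [hfin, ← Complex.exp_sum]
  have hs : HasSum (fun i => ⟪B h, b i⟫_ℝ * ⟪b i, B h⟫_ℝ) ⟪C h, h⟫_ℝ := by
    rw [← inner_posSqrt hC]
    exact b.hasSum_inner_mul_inner (B h) (B h)
  have hs2 := ((Complex.hasSum_ofReal.2 hs).neg.div_const 2)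
  exact (Complex.continuous_exp.tendsto _).comp hs2

theorem isCenteredGaussian_centeredGaussian {C : H → H}
    (h : ∃ μ : Measure H, IsCenteredGaussian C μ) :
    IsCenteredGaussian C (centeredGaussian C) :=
  Classical.epsilon_spec h

end Gaussian

end OrnsteinUhlenbeck

namespace OrnsteinUhlenbeck

/-! ### The covariance operators -/

section Trace

variable {H : Type*} [NormedAddCommGroup H] [InnerProductSpace ℝ H] [CompleteSpace H]

/-- The operator norm of T^{1/2} is at most its Hilbert–Schmidt norm, whose square is the trace. -/
lemma norm_apply_le_of_summable {T : H →L[ℝ] H} (hT : T.IsPositive) {ι : Type*}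
    (b : HilbertBasis ι ℝ H) (hs : Summable fun i => ⟪T (b i), b i⟫_ℝ) (x : H) :
    ‖T x‖ ≤ (∑' i, ⟪T (b i), b i⟫_ℝ) * ‖x‖ := by
  obtain ⟨hB, hBB⟩ := posSqrt_spec hT
  set B := posSqrt T
  set c := ∑' i, ⟪T (b i), b i⟫_ℝ
  have hc : 0 ≤ c := tsum_nonneg fun i => hT.inner_nonneg_left _
  have h1 : ∀ y, ‖B y‖ ≤ √c * ‖y‖ := fun y => by
    refine le_of_sq_le_sq ?_ (by positivity)
    rw [mul_pow, Real.sq_sqrt hc, ← real_inner_self_eq_norm_sq]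
    refine hasSum_le (fun i => ?_) (b.hasSum_inner_mul_inner (B y) (B y))
      (hs.hasSum.mul_right (‖y‖ ^ 2))
    rw [real_inner_comm, ← sq, ← hB.inner_left_eq_inner_right, ← norm_posSqrt_sq hT, ← mul_pow,
      ← sq_abs]
    exact pow_le_pow_left₀ (abs_nonneg _) (abs_real_inner_le_norm _ _) 2
  have h2 : T x = B (B x) := by rw [← hBB]; rfl
  rw [h2]
  calc ‖B (B x)‖ ≤ √c * (√c * ‖x‖) := (h1 _).trans
        (mul_le_mul_of_nonneg_left (h1 x) (Real.sqrt_nonneg _))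
    _ = c * ‖x‖ := by rw [← mul_assoc, Real.mul_self_sqrt hc]

lemma enorm_apply_le_posTrace {T : H →L[ℝ] H} (hT : T.IsPositive) (x : H) :
    ‖T x‖ₑ ≤ posTrace T * ‖x‖ₑ := by
  by_cases hx : x = 0
  · simp [hx]
  by_cases htop : posTrace T = ∞
  · rw [htop, ENNReal.top_mul (by simpa using hx)]
    exact le_top
  rw [posTrace] at htop ⊢
  set b := (exists_hilbertBasis ℝ H).choose_spec.choose
  have h0 : ∀ i, 0 ≤ ⟪T (b i), b i⟫_ℝ := fun i => hT.inner_nonneg_left _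
  have hs : Summable fun i => ⟪T (b i), b i⟫_ℝ := by
    have := ENNReal.summable_toReal htop
    refine this.congr fun i => ?_
    rw [ENNReal.toReal_ofReal (h0 i)]
  rw [← ENNReal.ofReal_tsum_of_nonneg h0 hs, ← ofReal_norm, ← ofReal_norm,
    ← ENNReal.ofReal_mul (tsum_nonneg h0)]
  exact ENNReal.ofReal_le_ofReal (norm_apply_le_of_summable hT b hs x)

lemma ofReal_sum_le_posTrace (T : H →L[ℝ] H) (hT : T.IsPositive)
    (s : Finset (exists_hilbertBasis ℝ H).choose) :
    ENNReal.ofReal (∑ i ∈ s, ⟪T ((exists_hilbertBasis ℝ H).choose_spec.choose i),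
      (exists_hilbertBasis ℝ H).choose_spec.choose i⟫_ℝ) ≤ posTrace T := by
  rw [ENNReal.ofReal_sum_of_nonneg fun i _ => hT.inner_nonneg_left _]
  exact ENNReal.sum_le_tsum s

end Trace

/-- A strongly continuous semigroup and a positive operator such that `Q_∞` is of trace class. -/
structure IsTraceClassPair {H : Type*} [NormedAddCommGroup H] [InnerProductSpace ℝ H]
    [CompleteSpace H] (S : ℝ≥0 → H →L[ℝ] H) (Q : H →L[ℝ] H) : Prop where
  semigroup : IsC0Semigroup S
  pos : Q.IsPositive
  trace : ∫⁻ s in Ioi (0 : ℝ), posTrace (S s.toNNReal ∘L Q ∘L (S s.toNNReal).adjoint) < ∞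

namespace IsTraceClassPair

variable {H : Type*} [NormedAddCommGroup H] [InnerProductSpace ℝ H] [CompleteSpace H]
  {S : ℝ≥0 → H →L[ℝ] H} {Q : H →L[ℝ] H}

lemma isPositive_conj (h : IsTraceClassPair S Q) (s : ℝ≥0) :
    (S s ∘L Q ∘L (S s).adjoint).IsPositive := h.pos.conj_adjoint (S s)

lemma continuous_integrand (h : IsTraceClassPair S Q) (x : H) :
    Continuous fun s : ℝ => S s.toNNReal (Q ((S s.toNNReal).adjoint x)) :=
  (h.semigroup.continuous_apply (Q.continuous.comp
    (h.semigroup.adjoint.continuous_orbit x))).comp continuous_real_toNNReal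

lemma lintegral_enorm_le (h : IsTraceClassPair S Q) (x : H) :
    ∫⁻ s in Ioi (0 : ℝ), ‖S s.toNNReal (Q ((S s.toNNReal).adjoint x))‖ₑ ≤
      (∫⁻ s in Ioi (0 : ℝ), posTrace (S s.toNNReal ∘L Q ∘L (S s.toNNReal).adjoint)) * ‖x‖ₑ := by
  -- This form needs only a finite constant, so measurability of the trace in s is never required.
  rw [← lintegral_mul_const' _ _ (by simp)]
  exact lintegral_mono fun s => enorm_apply_le_posTrace (h.isPositive_conj _) x

lemma integrableOn (h : IsTraceClassPair S Q) (x : H) :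
    IntegrableOn (fun s : ℝ => S s.toNNReal (Q ((S s.toNNReal).adjoint x))) (Ioi 0) :=
  ⟨(h.continuous_integrand x).aestronglyMeasurable,
    (h.lintegral_enorm_le x).trans_lt (ENNReal.mul_lt_top h.trace (by simp))⟩

lemma exists_covCLM (h : IsTraceClassPair S Q) {I : Set ℝ} (hI : I ⊆ Ioi 0) :
    ∃ C : H →L[ℝ] H, ∀ x, C x = covOp S Q I x := by
  have hi : ∀ x, IntegrableOn (fun s : ℝ => S s.toNNReal (Q ((S s.toNNReal).adjoint x))) I :=
    fun x => (h.integrableOn x).mono_set hI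
  refine ⟨LinearMap.mkContinuous
    { toFun := covOp S Q I
      map_add' := fun x y => by
        rw [covOp, covOp, covOp, ← integral_add (hi x) (hi y)]
        exact integral_congr_ae (Filter.Eventually.of_forall fun s => by simp only [map_add])
      map_smul' := fun a x => by
        rw [covOp, covOp, RingHom.id_apply, ← integral_smul]
        exact integral_congr_ae (Filter.Eventually.of_forall fun s => by simp only [map_smul]) }
    (∫⁻ s in Ioi (0 : ℝ), posTrace (S s.toNNReal ∘L Q ∘L (S s.toNNReal).adjoint)).toReal ?_,
    fun x => rfl⟩
  intro x
  have h1 : ‖covOp S Q I x‖ₑ ≤ (∫⁻ s in Ioi (0 : ℝ),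
      posTrace (S s.toNNReal ∘L Q ∘L (S s.toNNReal).adjoint)) * ‖x‖ₑ :=
    (enorm_integral_le_lintegral_enorm _).trans
      ((lintegral_mono_set hI).trans (h.lintegral_enorm_le x))
  have h2 := ENNReal.toReal_mono (ENNReal.mul_lt_top h.trace (by simp)).ne h1
  rwa [ENNReal.toReal_mul, toReal_enorm, toReal_enorm] at h2

/-- `covOp` as a bounded operator. -/
noncomputable def covCLM (h : IsTraceClassPair S Q) {I : Set ℝ} (hI : I ⊆ Ioi 0) : H →L[ℝ] H :=
  (h.exists_covCLM hI).choose

lemma covCLM_apply (h : IsTraceClassPair S Q) {I : Set ℝ} (hI : I ⊆ Ioi 0) (x : H) :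
    h.covCLM hI x = covOp S Q I x := (h.exists_covCLM hI).choose_spec x

lemma coe_covCLM (h : IsTraceClassPair S Q) {I : Set ℝ} (hI : I ⊆ Ioi 0) :
    ⇑(h.covCLM hI) = covOp S Q I := funext (h.covCLM_apply hI)

lemma integrableOn_inner (h : IsTraceClassPair S Q) {I : Set ℝ} (hI : I ⊆ Ioi 0) (x y : H) :
    IntegrableOn (fun s : ℝ => ⟪Q ((S s.toNNReal).adjoint x), (S s.toNNReal).adjoint y⟫_ℝ) I := by
  have := ((h.integrableOn x).mono_set hI).inner_const (𝕜 := ℝ) y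
  refine this.congr (Filter.Eventually.of_forall fun s => ?_)
  simp only [ContinuousLinearMap.adjoint_inner_right]

lemma inner_covCLM (h : IsTraceClassPair S Q) {I : Set ℝ} (hI : I ⊆ Ioi 0) (x y : H) :
    ⟪h.covCLM hI x, y⟫_ℝ =
      ∫ s in I, ⟪Q ((S s.toNNReal).adjoint x), (S s.toNNReal).adjoint y⟫_ℝ := by
  rw [covCLM_apply, covOp, real_inner_comm, ← integral_inner ((h.integrableOn x).mono_set hI)]
  refine integral_congr_ae (Filter.Eventually.of_forall fun s => ?_)
  simp only [ContinuousLinearMap.adjoint_inner_right, real_inner_comm]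

lemma isPositive_covCLM (h : IsTraceClassPair S Q) {I : Set ℝ} (hI : I ⊆ Ioi 0) :
    (h.covCLM hI).IsPositive := by
  rw [ContinuousLinearMap.isPositive_iff]
  refine ⟨fun x y => ?_, fun x => ?_⟩
  · change ⟪h.covCLM hI x, y⟫_ℝ = ⟪x, h.covCLM hI y⟫_ℝ
    rw [real_inner_comm _ x, inner_covCLM, inner_covCLM]
    refine integral_congr_ae (Filter.Eventually.of_forall fun s => ?_)
    simp only
    rw [h.pos.inner_left_eq_inner_right, real_inner_comm]
  · rw [inner_covCLM]
    exact integral_nonneg fun s => h.pos.inner_nonneg_left _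

/-- Finite partial sums can be taken under the integral, where the trace of the integrand dominates
them. -/
lemma summable_inner_covCLM (h : IsTraceClassPair S Q) {I : Set ℝ} (hI : I ⊆ Ioi 0) :
    Summable fun i => ⟪h.covCLM hI ((exists_hilbertBasis ℝ H).choose_spec.choose i),
      (exists_hilbertBasis ℝ H).choose_spec.choose i⟫_ℝ := by
  refine summable_of_sum_le (c := (∫⁻ s in Ioi (0 : ℝ),
    posTrace (S s.toNNReal ∘L Q ∘L (S s.toNNReal).adjoint)).toReal)
    (fun i => (h.isPositive_covCLM hI).inner_nonneg_left _) fun s => ?_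
  set b := (exists_hilbertBasis ℝ H).choose_spec.choose with hb
  simp_rw [inner_covCLM]
  rw [← integral_finsetSum _ fun i _ => h.integrableOn_inner hI _ _]
  rw [← ENNReal.ofReal_le_iff_le_toReal h.trace.ne, ofReal_integral_eq_lintegral_ofReal
    (integrable_finsetSum _ fun i _ => h.integrableOn_inner hI _ _)
    (Filter.Eventually.of_forall fun s => Finset.sum_nonneg fun i _ =>
      h.pos.inner_nonneg_left _)]
  refine (lintegral_mono fun t => ?_).trans (lintegral_mono_set hI)
  refine le_trans (le_of_eq ?_) (ofReal_sum_le_posTrace _ (h.isPositive_conj t.toNNReal) s)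
  congr 1
  refine Finset.sum_congr rfl fun i _ => ?_
  rw [ContinuousLinearMap.adjoint_inner_right]
  rfl

/-- The Gaussian measures `N(0, Q_t)` and `N(0, Q_∞)` exist. -/
theorem isCenteredGaussian [TopologicalSpace.SeparableSpace H] [MeasurableSpace H] [BorelSpace H]
    (h : IsTraceClassPair S Q) {I : Set ℝ} (hI : I ⊆ Ioi 0) :
    IsCenteredGaussian (covOp S Q I) (centeredGaussian (covOp S Q I)) := by
  refine isCenteredGaussian_centeredGaussian ?_
  rw [← h.coe_covCLM hI]
  exact exists_isCenteredGaussian (h.isPositive_covCLM hI) _ (h.summable_inner_covCLM hI)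

/-- The operator `Q_∞`. -/
noncomputable abbrev covInf (h : IsTraceClassPair S Q) : H →L[ℝ] H := h.covCLM Subset.rfl

/-- The operator `Q_t`. -/
noncomputable abbrev cov (h : IsTraceClassPair S Q) (t : ℝ≥0) : H →L[ℝ] H :=
  h.covCLM (I := Ioc 0 (t : ℝ)) Ioc_subset_Ioi_self

lemma inner_covInf_adjoint (h : IsTraceClassPair S Q) (t : ℝ≥0) (x y : H) :
    ⟪h.covInf ((S t).adjoint x), (S t).adjoint y⟫_ℝ =
      ∫ s in Ioi (t : ℝ), ⟪Q ((S s.toNNReal).adjoint x), (S s.toNNReal).adjoint y⟫_ℝ := by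
  rw [inner_covCLM]
  have h1 := (measurePreserving_add_right (volume : Measure ℝ) (t : ℝ)).setIntegral_preimage_emb
    (measurableEmbedding_addRight (t : ℝ))
    (fun s => ⟪Q ((S s.toNNReal).adjoint x), (S s.toNNReal).adjoint y⟫_ℝ) (Ioi (t : ℝ))
  have h2 : (fun s : ℝ => s + t) ⁻¹' Ioi (t : ℝ) = Ioi 0 := by ext s; simp
  rw [h2] at h1
  rw [← h1]
  refine setIntegral_congr_fun measurableSet_Ioi fun s hs => ?_
  rw [Real.toNNReal_add (le_of_lt (mem_Ioi.1 hs)) t.coe_nonneg, Real.toNNReal_coe,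
    add_comm, h.semigroup.map_add, ContinuousLinearMap.adjoint_comp,
    ContinuousLinearMap.comp_apply, ContinuousLinearMap.comp_apply]

/-- The integral is split at t: Q_∞ = Q_t + S(t) Q_∞ S*(t). This is invariance of μ at the level of
covariances. -/
lemma inner_covInf_eq_add (h : IsTraceClassPair S Q) (t : ℝ≥0) (x y : H) :
    ⟪h.covInf x, y⟫_ℝ =
      ⟪h.cov t x, y⟫_ℝ + ⟪h.covInf ((S t).adjoint x), (S t).adjoint y⟫_ℝ := by
  rw [inner_covInf_adjoint, inner_covCLM, inner_covCLM, ← setIntegral_union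
    (Ioc_disjoint_Ioi le_rfl) measurableSet_Ioi (h.integrableOn_inner Ioc_subset_Ioi_self x y)
    (h.integrableOn_inner (Ioi_subset_Ioi t.coe_nonneg) x y),
    Ioc_union_Ioi_eq_Ioi t.coe_nonneg]

/-- Tails of a convergent integral; this is the source of the strong decay of the powers of S_0(t).
-/
lemma tendsto_inner_covInf_adjoint (h : IsTraceClassPair S Q) {t : ℝ≥0} (ht : 0 < t) (x : H) :
    Filter.Tendsto (fun n : ℕ => ⟪h.covInf ((S (n * t)).adjoint x), (S (n * t)).adjoint x⟫_ℝ)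
      Filter.atTop (nhds 0) := by
  simp_rw [inner_covInf_adjoint]
  have h1 := tendsto_setIntegral_of_antitone (μ := volume)
    (f := fun s : ℝ => ⟪Q ((S s.toNNReal).adjoint x), (S s.toNNReal).adjoint x⟫_ℝ)
    (s := fun n : ℕ => Ioi ((n * t : ℝ≥0) : ℝ)) (fun _ => measurableSet_Ioi)
    (fun m n hmn => Ioi_subset_Ioi (by push_cast; gcongr))
    ⟨0, by simpa using h.integrableOn_inner Subset.rfl x x⟩
  have h2 : ⋂ n : ℕ, Ioi ((n * t : ℝ≥0) : ℝ) = ∅ := by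
    refine eq_empty_of_forall_notMem fun s hs => ?_
    obtain ⟨n, hn⟩ := exists_nat_ge (s / t)
    refine absurd (mem_Ioi.1 (mem_iInter.1 hs n)) (not_lt.2 ?_)
    push_cast
    rwa [div_le_iff₀ (by exact_mod_cast ht)] at hn
  rw [h2, setIntegral_empty] at h1
  exact h1

end IsTraceClassPair

end OrnsteinUhlenbeck

namespace OrnsteinUhlenbeck

/-! ### Trigonometric integrals of Gaussian measures -/

section Trig

open Filter

variable {H : Type*} [NormedAddCommGroup H] [InnerProductSpace ℝ H] [CompleteSpace H]
  [TopologicalSpace.SeparableSpace H] [MeasurableSpace H] [BorelSpace H]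

lemma integrable_cos_inner (μ : Measure H) [IsFiniteMeasure μ] (h : H) :
    Integrable (fun x => Real.cos ⟪x, h⟫_ℝ) μ :=
  Integrable.of_bound (C := 1) (by fun_prop)
    (Eventually.of_forall fun _ => Real.abs_cos_le_one _)

lemma integrable_sin_inner (μ : Measure H) [IsFiniteMeasure μ] (h : H) :
    Integrable (fun x => Real.sin ⟪x, h⟫_ℝ) μ :=
  Integrable.of_bound (C := 1) (by fun_prop)
    (Eventually.of_forall fun _ => Real.abs_sin_le_one _)

lemma charFun_eq_cos_add_sin (μ : Measure H) [IsFiniteMeasure μ] (h : H) :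
    charFun μ h = ((∫ x, Real.cos ⟪x, h⟫_ℝ ∂μ : ℝ) : ℂ)
      + ((∫ x, Real.sin ⟪x, h⟫_ℝ ∂μ : ℝ) : ℂ) * Complex.I := by
  rw [charFun_apply, ← integral_complex_ofReal, ← integral_complex_ofReal, ← integral_mul_const,
    ← integral_add (integrable_cos_inner μ h).ofReal
      ((integrable_sin_inner μ h).ofReal.mul_const _)]
  refine integral_congr_ae (Eventually.of_forall fun x => ?_)
  simp only [Complex.exp_mul_I, Complex.ofReal_cos, Complex.ofReal_sin]

variable {C : H → H} {μ : Measure H}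

lemma IsCenteredGaussian.integral_cos (hμ : IsCenteredGaussian C μ) (h : H) :
    ∫ x, Real.cos ⟪x, h⟫_ℝ ∂μ = Real.exp (-⟪C h, h⟫_ℝ / 2) := by
  have := hμ.1
  have h1 := hμ.2 h
  rw [charFun_eq_cos_add_sin] at h1
  have h2 : Complex.exp (-(⟪C h, h⟫_ℝ : ℂ) / 2) = ((Real.exp (-⟪C h, h⟫_ℝ / 2) : ℝ) : ℂ) := by
    push_cast; rfl
  rw [h2] at h1
  have := congrArg Complex.re h1
  rwa [Complex.add_re, Complex.ofReal_re, Complex.re_ofReal_mul, Complex.I_re, mul_zero, add_zero,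
    Complex.ofReal_re] at this

lemma IsCenteredGaussian.integral_sin (hμ : IsCenteredGaussian C μ) (h : H) :
    ∫ x, Real.sin ⟪x, h⟫_ℝ ∂μ = 0 := by
  have := hμ.1
  have h1 := hμ.2 h
  rw [charFun_eq_cos_add_sin] at h1
  have h2 : Complex.exp (-(⟪C h, h⟫_ℝ : ℂ) / 2) = ((Real.exp (-⟪C h, h⟫_ℝ / 2) : ℝ) : ℂ) := by
    push_cast; rfl
  rw [h2] at h1
  have := congrArg Complex.im h1
  rwa [Complex.add_im, Complex.ofReal_im, Complex.im_ofReal_mul, Complex.I_im, mul_one, zero_add,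
    Complex.ofReal_im] at this

/-- The function `x ↦ e^{⟪C h, h⟫ / 2} (cos ⟪x, h⟫ + sin ⟪x, h⟫)`. -/
noncomputable def trigExp (C : H → H) (h x : H) : ℝ :=
  Real.exp (⟪C h, h⟫_ℝ / 2) * (Real.cos ⟪x, h⟫_ℝ + Real.sin ⟪x, h⟫_ℝ)

lemma isBoundedBorel_trigExp (C : H → H) (h : H) : IsBoundedBorel (trigExp C h) := by
  refine ⟨by unfold trigExp; fun_prop, Real.exp (⟪C h, h⟫_ℝ / 2) * 2, fun x => ?_⟩
  rw [trigExp, abs_mul, abs_of_nonneg (Real.exp_pos _).le]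
  refine mul_le_mul_of_nonneg_left ((abs_add_le _ _).trans ?_) (Real.exp_pos _).le
  linarith [Real.abs_cos_le_one ⟪x, h⟫_ℝ, Real.abs_sin_le_one ⟪x, h⟫_ℝ]

/-- Up to constants the product is cos ⟪x, h - k⟫ + sin ⟪x, h + k⟫. The sine integrates to 0 by
centering, and the cosine leaves the cross term. -/
lemma IsCenteredGaussian.integral_trigExp_mul {C : H →L[ℝ] H} (hC : C.IsPositive)
    (hμ : IsCenteredGaussian C μ) (h k : H) :
    ∫ x, trigExp C h x * trigExp C k x ∂μ = Real.exp ⟪C h, k⟫_ℝ := by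
  have := hμ.1
  have h1 : ∀ x, trigExp C h x * trigExp C k x =
      Real.exp (⟪C h, h⟫_ℝ / 2 + ⟪C k, k⟫_ℝ / 2) *
        (Real.cos ⟪x, h - k⟫_ℝ + Real.sin ⟪x, h + k⟫_ℝ) := fun x => by
    rw [trigExp, trigExp, Real.exp_add, inner_sub_right, inner_add_right, Real.cos_sub,
      Real.sin_add]
    ring
  simp_rw [h1]
  rw [integral_const_mul, integral_add (integrable_cos_inner μ _) (integrable_sin_inner μ _),
    hμ.integral_cos, hμ.integral_sin, add_zero, ← Real.exp_add]
  congr 1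
  have h2 : ⟪C k, h⟫_ℝ = ⟪C h, k⟫_ℝ := by
    rw [hC.inner_left_eq_inner_right, real_inner_comm]
  rw [map_sub, inner_sub_left, inner_sub_right, inner_sub_right, h2]
  ring

/-- Integrating over y kills the sine and yields the factor exp(-⟪C' h, h⟫/2), which by `hA` turns
the normalisation for h into that for A* h. -/
lemma IsCenteredGaussian.integral_trigExp_add {C C' : H → H} {ν : Measure H}
    (hν : IsCenteredGaussian C' ν) (A : H →L[ℝ] H)
    (hA : ∀ h, ⟪C h, h⟫_ℝ = ⟪C' h, h⟫_ℝ + ⟪C (A.adjoint h), A.adjoint h⟫_ℝ) (h x : H) :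
    ∫ y, trigExp C h (A x + y) ∂ν = trigExp C (A.adjoint h) x := by
  have := hν.1
  have h1 : ∀ y, trigExp C h (A x + y) = Real.exp (⟪C h, h⟫_ℝ / 2) *
      ((Real.cos ⟪A x, h⟫_ℝ + Real.sin ⟪A x, h⟫_ℝ) * Real.cos ⟪y, h⟫_ℝ +
        (Real.cos ⟪A x, h⟫_ℝ - Real.sin ⟪A x, h⟫_ℝ) * Real.sin ⟪y, h⟫_ℝ) := fun y => by
    rw [trigExp, inner_add_left, Real.cos_add, Real.sin_add]
    ring
  simp_rw [h1]
  rw [integral_const_mul, integral_add ((integrable_cos_inner ν _).const_mul _)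
    ((integrable_sin_inner ν _).const_mul _), integral_const_mul, integral_const_mul,
    hν.integral_cos, hν.integral_sin, trigExp, hA, ← ContinuousLinearMap.adjoint_inner_right A x h]
  rw [mul_zero, add_zero, mul_comm _ (Real.exp _), ← mul_assoc, ← Real.exp_add]
  congr 2
  ring

/-- A function all of whose Fourier coefficients vanish is zero almost everywhere. -/
theorem ae_eq_zero_of_integral_cos_sin {μ : Measure H} [IsFiniteMeasure μ] {f : H → ℝ}
    (hf : Integrable f μ) (hcos : ∀ h, ∫ x, f x * Real.cos ⟪x, h⟫_ℝ ∂μ = 0)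
    (hsin : ∀ h, ∫ x, f x * Real.sin ⟪x, h⟫_ℝ ∂μ = 0) : f =ᵐ[μ] 0 := by
  let p : H → ℝ≥0∞ := fun x => ENNReal.ofReal (f x)
  let n : H → ℝ≥0∞ := fun x => ENNReal.ofReal (-f x)
  have hp : AEMeasurable p μ := hf.aestronglyMeasurable.aemeasurable.ennreal_ofReal
  have hn : AEMeasurable n μ := hf.aestronglyMeasurable.aemeasurable.neg.ennreal_ofReal
  have hpf : ∫⁻ x, p x ∂μ ≠ ∞ := hf.lintegral_lt_top.ne
  have hnf : ∫⁻ x, n x ∂μ ≠ ∞ := hf.neg.lintegral_lt_top.ne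
  have i1 : IsFiniteMeasure (μ.withDensity p) := isFiniteMeasure_withDensity hpf
  have i2 : IsFiniteMeasure (μ.withDensity n) := isFiniteMeasure_withDensity hnf
  have key : ∀ (u : ℝ → ℝ) (_ : Continuous u) (_ : ∀ r, |u r| ≤ 1) (h : H)
      (_ : ∫ x, f x * u ⟪x, h⟫_ℝ ∂μ = 0),
      ∫ x, u ⟪x, h⟫_ℝ ∂(μ.withDensity p) = ∫ x, u ⟪x, h⟫_ℝ ∂(μ.withDensity n) := by
    intro u hu hu1 h h0
    rw [integral_withDensity_eq_integral_toReal_smul₀ hp (by simp [p]),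
      integral_withDensity_eq_integral_toReal_smul₀ hn (by simp [n]), ← sub_eq_zero]
    have hub : ∀ g : H → ℝ, Integrable g μ → Integrable (fun x => g x • u ⟪x, h⟫_ℝ) μ := by
      intro g hg
      refine hg.mul_bdd (c := 1) ?_ (Eventually.of_forall fun x => ?_)
      · have : Continuous fun x : H => u ⟪x, h⟫_ℝ := by fun_prop
        exact this.aestronglyMeasurable
      · exact hu1 _
    rw [← integral_sub (hub _ (integrable_toReal_of_lintegral_ne_top hp hpf))
      (hub _ (integrable_toReal_of_lintegral_ne_top hn hnf)), ← h0]
    refine integral_congr_ae (Eventually.of_forall fun x => ?_)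
    simp only [p, n, smul_eq_mul, ENNReal.toReal_ofReal', ← sub_mul]
    congr 1
    rcases le_total 0 (f x) with h | h
    · rw [max_eq_left h, max_eq_right (by linarith)]; ring
    · rw [max_eq_right h, max_eq_left (by linarith)]; ring
  -- The positive and negative parts of f are densities of finite measures with equal characteristic
  -- functionals.
  have heq : μ.withDensity p = μ.withDensity n := by
    refine Measure.ext_of_charFun (funext fun h => ?_)
    rw [charFun_eq_cos_add_sin, charFun_eq_cos_add_sin,
      key Real.cos Real.continuous_cos Real.abs_cos_le_one h (hcos h),
      key Real.sin Real.continuous_sin Real.abs_sin_le_one h (hsin h)]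
  have hae := (withDensity_eq_iff hp hn hpf).1 heq
  filter_upwards [hae] with x hx
  simp only [p, n] at hx
  have h2 := congrArg ENNReal.toReal hx
  rw [ENNReal.toReal_ofReal', ENNReal.toReal_ofReal'] at h2
  simp only [Pi.zero_apply]
  rcases le_total 0 (f x) with h | h
  · rw [max_eq_left h, max_eq_right (by linarith)] at h2; exact h2
  · rw [max_eq_right h, max_eq_left (by linarith)] at h2; linarith

lemma IsBoundedBorel.memLp {X : Type*} [MeasurableSpace X] {φ : X → ℝ} (hφ : IsBoundedBorel φ)
    (μ : Measure X)
    [IsFiniteMeasure μ] : MemLp φ 2 μ := by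
  obtain ⟨hm, c, hc⟩ := hφ
  exact MemLp.of_bound hm.aestronglyMeasurable c (Eventually.of_forall hc)

/-- `trigExp` as an element of `L²`. -/
noncomputable def trigExpLp (C : H → H) (μ : Measure H) [IsFiniteMeasure μ] (h : H) : Lp ℝ 2 μ :=
  ((isBoundedBorel_trigExp C h).memLp μ).toLp _

lemma coeFn_trigExpLp (C : H → H) (μ : Measure H) [IsFiniteMeasure μ] (h : H) :
    trigExpLp C μ h =ᵐ[μ] trigExp C h := MemLp.coeFn_toLp _

lemma inner_trigExpLp {C : H →L[ℝ] H} (hC : C.IsPositive) [IsFiniteMeasure μ]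
    (hμ : IsCenteredGaussian C μ) (h k : H) :
    ⟪trigExpLp C μ h, trigExpLp C μ k⟫_ℝ = Real.exp ⟪C h, k⟫_ℝ := by
  rw [← hμ.integral_trigExp_mul hC, L2.inner_def]
  refine integral_congr_ae ?_
  filter_upwards [coeFn_trigExpLp C μ h, coeFn_trigExpLp C μ k] with x h1 h2
  rw [h1, h2, mul_comm]
  rfl

theorem dense_span_trigExpLp (C : H →L[ℝ] H) (μ : Measure H) [IsFiniteMeasure μ] :
    Dense (Submodule.span ℝ (range (trigExpLp C μ)) : Set (Lp ℝ 2 μ)) := by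
  rw [Submodule.dense_iff_topologicalClosure_eq_top, Submodule.topologicalClosure_eq_top_iff,
    eq_bot_iff]
  intro f hf
  have h0 : ∀ h, ∫ x, f x * trigExp C h x ∂μ = 0 := fun h => by
    have h1 : ⟪trigExpLp C μ h, f⟫_ℝ = 0 := hf _ (Submodule.subset_span ⟨h, rfl⟩)
    rw [L2.inner_def] at h1
    rw [← h1]
    refine integral_congr_ae ?_
    filter_upwards [coeFn_trigExpLp C μ h] with x h2
    rw [h2]
    rfl
  have hfi : Integrable f μ := (Lp.memLp f).integrable (by norm_num)
  have hi : ∀ u : H → ℝ, Continuous u → (∀ x, |u x| ≤ 1) → Integrable (fun x => f x * u x) μ :=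
    fun u hu hb => hfi.mul_bdd (c := 1) hu.aestronglyMeasurable (Eventually.of_forall hb)
  have hic : ∀ h, Integrable (fun x => f x * Real.cos ⟪x, h⟫_ℝ) μ := fun h =>
    hi _ (by fun_prop) fun _ => Real.abs_cos_le_one _
  have his : ∀ h, Integrable (fun x => f x * Real.sin ⟪x, h⟫_ℝ) μ := fun h =>
    hi _ (by fun_prop) fun _ => Real.abs_sin_le_one _
  have h1 : ∀ h, (∫ x, f x * Real.cos ⟪x, h⟫_ℝ ∂μ) + ∫ x, f x * Real.sin ⟪x, h⟫_ℝ ∂μ = 0 := by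
    intro h
    rw [← integral_add (hic h) (his h)]
    have h2 : ∀ x, f x * trigExp C h x = Real.exp (⟪C h, h⟫_ℝ / 2) *
        (f x * Real.cos ⟪x, h⟫_ℝ + f x * Real.sin ⟪x, h⟫_ℝ) := fun x => by
      rw [trigExp]; ring
    have h3 := h0 h
    simp_rw [h2] at h3
    rw [integral_const_mul] at h3
    exact (mul_eq_zero.1 h3).resolve_left (Real.exp_pos _).ne'
  -- Replacing h by -h flips the sine only, so both Fourier coefficients vanish separately.
  have h2 : ∀ h, (∫ x, f x * Real.cos ⟪x, h⟫_ℝ ∂μ) - ∫ x, f x * Real.sin ⟪x, h⟫_ℝ ∂μ = 0 := by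
    intro h
    have := h1 (-h)
    simp only [inner_neg_right, Real.cos_neg, Real.sin_neg, mul_neg, integral_neg] at this
    linarith
  have h3 := ae_eq_zero_of_integral_cos_sin hfi (fun h => by linarith [h1 h, h2 h])
    fun h => by linarith [h1 h, h2 h]
  exact (Submodule.mem_bot ℝ).2 ((Lp.eq_zero_iff_ae_eq_zero).2 h3)

end Trig

/-! ### Mehler operators on `L²` -/

section Mehler

open Filter

variable {H : Type*} [NormedAddCommGroup H] [InnerProductSpace ℝ H] [CompleteSpace H]
  [TopologicalSpace.SeparableSpace H] [MeasurableSpace H] [BorelSpace H]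

/-- The law of A X + Y for independent X and Y has the product of the two characteristic
functionals, and `hA` adds up the exponents. -/
lemma measurePreserving_of_gaussian {C C' : H → H} {μ ν : Measure H}
    (hμ : IsCenteredGaussian C μ) (hν : IsCenteredGaussian C' ν) (A : H →L[ℝ] H)
    (hA : ∀ h, ⟪C h, h⟫_ℝ = ⟪C' h, h⟫_ℝ + ⟪C (A.adjoint h), A.adjoint h⟫_ℝ) :
    MeasurePreserving (fun p : H × H => A p.1 + p.2) (μ.prod ν) μ := by
  have : SecondCountableTopology H := UniformSpace.secondCountable_of_separable H
  have := hμ.1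
  have := hν.1
  have hm : Measurable fun p : H × H => A p.1 + p.2 := by fun_prop
  refine ⟨hm, ?_⟩
  have := Measure.isProbabilityMeasure_map (μ := μ.prod ν) hm.aemeasurable
  refine Measure.ext_of_charFun (funext fun h => ?_)
  rw [charFun_apply, integral_map hm.aemeasurable (by fun_prop)]
  have h1 : ∀ p : H × H, Complex.exp ((⟪A p.1 + p.2, h⟫_ℝ : ℂ) * Complex.I) =
      Complex.exp ((⟪p.1, A.adjoint h⟫_ℝ : ℂ) * Complex.I) *
        Complex.exp ((⟪p.2, h⟫_ℝ : ℂ) * Complex.I) := fun p => by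
    rw [← Complex.exp_add, inner_add_left, ContinuousLinearMap.adjoint_inner_right]
    congr 1
    push_cast
    ring
  simp_rw [h1]
  rw [integral_prod_mul (fun x : H => Complex.exp ((⟪x, A.adjoint h⟫_ℝ : ℂ) * Complex.I))
    (fun y : H => Complex.exp ((⟪y, h⟫_ℝ : ℂ) * Complex.I)), ← charFun_apply, ← charFun_apply,
    hμ.2, hν.2, hμ.2, ← Complex.exp_add, hA h]
  congr 1
  push_cast
  ring

variable {A : H →L[ℝ] H} {μ ν : Measure H} [IsProbabilityMeasure μ] [IsProbabilityMeasure ν]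

/-- The operator `φ ↦ ∫ φ(A x + y) ν(dy)` on `L²(μ)`, when `μ` is invariant. -/
noncomputable def mehlerOp
    (hA : MeasurePreserving (fun p : H × H => A p.1 + p.2) (μ.prod ν) μ) :
    Lp ℝ 2 μ →L[ℝ] Lp ℝ 2 μ :=
  (Lp.compMeasurePreservingₗᵢ ℝ Prod.fst
    (measurePreserving_fst (μ := μ) (ν := ν))).toContinuousLinearMap.adjoint ∘L
  (Lp.compMeasurePreservingₗᵢ ℝ _ hA).toContinuousLinearMap

/-- The adjoint of composition with the first projection integrates out the second variable; tested
against g, this is Fubini. -/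
lemma mehlerOp_ae_eq (hA : MeasurePreserving (fun p : H × H => A p.1 + p.2) (μ.prod ν) μ)
    {φ : H → ℝ} (hφ : IsBoundedBorel φ) {f : Lp ℝ 2 μ} (hf : f =ᵐ[μ] φ) :
    mehlerOp hA f =ᵐ[μ] fun x => ∫ y, φ (A x + y) ∂ν := by
  have : SecondCountableTopology H := UniformSpace.secondCountable_of_separable H
  obtain ⟨hφm, c, hc⟩ := hφ
  have hm : StronglyMeasurable fun x => ∫ y, φ (A x + y) ∂ν := by
    refine StronglyMeasurable.integral_prod_right' (f := fun p : H × H => φ (A p.1 + p.2)) ?_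
    have : Measurable fun p : H × H => φ (A p.1 + p.2) := by fun_prop
    exact this.stronglyMeasurable
  have hb : ∀ x, ‖∫ y, φ (A x + y) ∂ν‖ ≤ c := fun x => by
    have := norm_integral_le_of_norm_le_const (μ := ν) (f := fun y => φ (A x + y)) (C := c)
      (Eventually.of_forall fun y => hc _)
    simpa using this
  have hmem : MemLp (fun x => ∫ y, φ (A x + y) ∂ν) 2 μ :=
    MemLp.of_bound hm.aestronglyMeasurable c (Eventually.of_forall hb)
  suffices h : mehlerOp hA f = hmem.toLp _ by
    rw [h]; exact hmem.coeFn_toLp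
  refine ext_inner_right ℝ fun g => ?_
  rw [mehlerOp, ContinuousLinearMap.comp_apply, ContinuousLinearMap.adjoint_inner_left,
    L2.inner_def, L2.inner_def]
  have h1 : ∀ᵐ p ∂(μ.prod ν), f (A p.1 + p.2) = φ (A p.1 + p.2) := hA.quasiMeasurePreserving.ae hf
  have hgi : Integrable g μ := (Lp.memLp g).integrable (by norm_num)
  have hgi' : Integrable (fun p : H × H => g p.1) (μ.prod ν) := hgi.comp_fst ν
  have hint : Integrable (fun p : H × H => g p.1 * φ (A p.1 + p.2)) (μ.prod ν) := by
    refine hgi'.mul_bdd (c := c) ?_ (Eventually.of_forall fun p => hc _)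
    have : Measurable fun p : H × H => φ (A p.1 + p.2) := by fun_prop
    exact this.aestronglyMeasurable
  have h2 : ∫ p, g p.1 * φ (A p.1 + p.2) ∂(μ.prod ν) = ∫ x, g x * ∫ y, φ (A x + y) ∂ν ∂μ := by
    rw [integral_prod _ hint]
    simp_rw [integral_const_mul]
  trans ∫ p, g p.1 * φ (A p.1 + p.2) ∂(μ.prod ν)
  · refine integral_congr_ae ?_
    filter_upwards [h1, Lp.coeFn_compMeasurePreserving f hA,
      Lp.coeFn_compMeasurePreserving g (measurePreserving_fst (μ := μ) (ν := ν))] with p h3 h4 h5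
    simp only [LinearIsometry.coe_toContinuousLinearMap, Lp.compMeasurePreservingₗᵢ_apply_coe]
    erw [h4, h5]
    simp only [Function.comp_apply, h3]
    rfl
  · rw [h2]
    refine integral_congr_ae ?_
    filter_upwards [hmem.coeFn_toLp] with x hx
    rw [hx]
    rfl

end Mehler

end OrnsteinUhlenbeck

namespace OrnsteinUhlenbeck

/-! ### Compact selfadjoint operators with vanishing powers -/

section Spectral

open Filter Topology

universe u

variable {H : Type u} [NormedAddCommGroup H] [InnerProductSpace ℝ H] [CompleteSpace H]

/-- Strong decay of the powers forces |l i| < 1 for each i; since only finitely many eigenvalues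
have modulus at least 1/2, the bound is uniform. -/
theorem exists_eigenbasis_lt_one {T : H →L[ℝ] H} (hT : IsCompactOperator T) (hs : T.IsSymmetric)
    (h0 : ∀ y, Tendsto (fun n : ℕ => (T ^ n) y) atTop (𝓝 0)) :
    ∃ (ι : Type u) (b : HilbertBasis ι ℝ H) (l : ι → ℝ) (q : ℝ), (∀ i, T (b i) = l i • b i) ∧
      0 < q ∧ q < 1 ∧ (∀ i, |l i| ≤ q) ∧ (∀ ε > 0, {i | ε ≤ |l i|}.Finite) ∧ ‖T‖ ≤ q := by
  obtain ⟨ι, b, l, hl⟩ := exists_eigenbasis hT hs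
  have hfin : ∀ ε > 0, {i | ε ≤ |l i|}.Finite := fun ε hε =>
    finite_setOf_le_eigenvalue hT b.orthonormal hl hε
  have hlt : ∀ i, |l i| < 1 := fun i => by
    rw [← tendsto_pow_atTop_nhds_zero_iff]
    have hpow : ∀ n : ℕ, (T ^ n) (b i) = l i ^ n • b i := fun n => by
      induction n with
      | zero => simp
      | succ n ih =>
        rw [pow_succ, mul_apply_eq_comp, hl, map_smul, ih, smul_smul, pow_succ']
    have h1 := (h0 (b i)).inner (𝕜 := ℝ) (tendsto_const_nhds (x := b i))
    simp only [hpow, real_inner_smul_left, inner_zero_left, real_inner_self_eq_norm_sq,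
      b.orthonormal.1 i, one_pow, mul_one] at h1
    exact h1
  -- The floor 1/2 keeps q positive even when T = 0, as needed for the logarithm of q later.
  obtain ⟨q, hq1, hq2, hq3⟩ : ∃ q : ℝ, 1 / 2 ≤ q ∧ q < 1 ∧ ∀ i, |l i| ≤ q := by
    have hF := hfin (1 / 2) (by norm_num)
    rcases {i | 1 / 2 ≤ |l i|}.eq_empty_or_nonempty with he | hne
    · refine ⟨1 / 2, le_rfl, by norm_num, fun i => ?_⟩
      by_contra hi
      have : i ∈ {i | 1 / 2 ≤ |l i|} := (not_le.1 hi).le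
      rw [he] at this
      exact this
    · obtain ⟨j, hj, hmax⟩ := exists_max_image _ (fun i => |l i|) hF hne
      refine ⟨|l j|, hj, hlt j, fun i => ?_⟩
      by_cases hi : 1 / 2 ≤ |l i|
      · exact hmax i hi
      · exact (not_le.1 hi).le.trans hj
  have hq0 : 0 < q := by linarith
  refine ⟨ι, b, l, q, hl, hq0, hq2, hq3, hfin, ?_⟩
  refine ContinuousLinearMap.opNorm_le_bound _ hq0.le fun x => ?_
  refine le_of_sq_le_sq ?_ (by positivity)
  rw [mul_pow, ← real_inner_self_eq_norm_sq, ← real_inner_self_eq_norm_sq]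
  refine hasSum_le (fun i => ?_) (b.hasSum_inner_mul_inner (T x) (T x))
    ((b.hasSum_inner_mul_inner x x).mul_left (q ^ 2))
  have h1 : ⟪b i, T x⟫_ℝ = l i * ⟪b i, x⟫_ℝ := by
    rw [← real_inner_smul_left, ← hl]; exact (hs _ _).symm
  rw [real_inner_comm (b i) (T x), real_inner_comm (b i) x, h1, mul_mul_mul_comm, ← sq]
  refine mul_le_mul_of_nonneg_right ?_ (mul_self_nonneg _)
  rw [← sq_abs (l i)]
  exact pow_le_pow_left₀ (abs_nonneg _) (hq3 i) 2

end Spectral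

/-! ### Semigroups intertwined by an operator with dense range -/

section Intertwine

open Filter Topology

variable {H : Type*} [NormedAddCommGroup H] [InnerProductSpace ℝ H] [CompleteSpace H]

lemma ext_of_denseRange {G A B : H →L[ℝ] H} (hG : DenseRange G) (h : ∀ x, A (G x) = B (G x)) :
    A = B :=
  DFunLike.coe_injective (hG.equalizer A.continuous B.continuous (funext h))

lemma isSymmetric_of_denseRange {G A : H →L[ℝ] H} (hG : DenseRange G)
    (h : ∀ x y, ⟪A (G x), G y⟫_ℝ = ⟪G x, A (G y)⟫_ℝ) : A.IsSymmetric := by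
  have h1 : ∀ x, ∀ v, ⟪A (G x), v⟫_ℝ = ⟪G x, A v⟫_ℝ := fun x v =>
    hG.induction_on (p := fun v => ⟪A (G x), v⟫_ℝ = ⟪G x, A v⟫_ℝ) v
      (isClosed_eq (by fun_prop) (by fun_prop)) (h x)
  intro u v
  exact hG.induction_on (p := fun u => ⟪A u, v⟫_ℝ = ⟪u, A v⟫_ℝ) u
      (isClosed_eq (by fun_prop) (by fun_prop)) fun x => h1 x v

lemma isC0Semigroup_of_intertwine {G : H →L[ℝ] H} (hG : DenseRange G) {T A : ℝ≥0 → H →L[ℝ] H}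
    (hT : IsC0Semigroup T) (hA : ∀ t x, A t (G x) = G (T t x)) (hA1 : ∀ t, ‖A t‖ ≤ 1) :
    IsC0Semigroup A := by
  refine IsC0Semigroup.of_tendsto_zero (ext_of_denseRange hG fun x => ?_)
    (fun s t => ext_of_denseRange hG fun x => ?_) (fun _ => ⟨1, fun s _ => hA1 s⟩) fun x => ?_
  · rw [hA, hT.zero_apply]; rfl
  · rw [hA, hT.add_apply, ContinuousLinearMap.comp_apply, hA, hA]
  · refine hG.induction_on (p := fun x => Tendsto (fun t => A t x) (𝓝 0) (𝓝 x)) x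
      (IsC0Semigroup.isClosed_tendsto_zero (M := 1) (Eventually.of_forall hA1)) fun y => ?_
    simp_rw [hA]
    have h1 := (G.continuous.comp (hT.continuous_orbit y)).tendsto 0
    simp only [Function.comp_apply, hT.zero_apply] at h1
    exact h1

end Intertwine

/-! ### The semigroups induced by S* on the forms of Q and Q_∞ -/

namespace IsTraceClassPair

open Filter Topology

variable {H : Type*} [NormedAddCommGroup H] [InnerProductSpace ℝ H] [CompleteSpace H]
  {S : ℝ≥0 → H →L[ℝ] H} {Q : H →L[ℝ] H}

/-- Symmetry of the adjoint semigroup with respect to the form of `Q_∞`. -/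
def IsSymm (h : IsTraceClassPair S Q) : Prop :=
  ∀ t x y, ⟪h.covInf ((S t).adjoint x), y⟫_ℝ = ⟪h.covInf x, (S t).adjoint y⟫_ℝ

lemma adjoint_comm (h : IsTraceClassPair S Q) (s t : ℝ≥0) (x : H) :
    (S s).adjoint ((S t).adjoint x) = (S t).adjoint ((S s).adjoint x) := by
  have h1 := h.semigroup.adjoint.add_apply s t x
  have h2 := h.semigroup.adjoint.add_apply t s x
  rw [← h1, ← h2, add_comm]

/-- Q_t = Q_∞ - S(t) Q_∞ S*(t), and the operators S* commute, so symmetry passes from Q_∞ to Q_t. -/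
lemma inner_cov_symm (h : IsTraceClassPair S Q) (hs : h.IsSymm) (t r : ℝ≥0) (x y : H) :
    ⟪h.cov t ((S r).adjoint x), y⟫_ℝ = ⟪h.cov t x, (S r).adjoint y⟫_ℝ := by
  have h1 := h.inner_covInf_eq_add t ((S r).adjoint x) y
  have h2 := h.inner_covInf_eq_add t x ((S r).adjoint y)
  rw [hs] at h1
  rw [h.adjoint_comm t r x, hs] at h1
  rw [h.adjoint_comm t r y] at h2
  linarith

lemma continuous_inner_integrand (h : IsTraceClassPair S Q) (x y : H) :
    Continuous fun s : ℝ => ⟪Q ((S s.toNNReal).adjoint x), (S s.toNNReal).adjoint y⟫_ℝ :=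
  (Q.continuous.comp (h.semigroup.adjoint.continuous_orbit_toNNReal x)).inner
    (h.semigroup.adjoint.continuous_orbit_toNNReal y)

/-- Q is the weak derivative of Q_t at 0, so relations and inequalities stable under limits pass
from Q_t to Q. -/
lemma tendsto_inv_mul_inner_cov (h : IsTraceClassPair S Q) (x y : H) :
    Tendsto (fun t : ℝ => t⁻¹ * ⟪h.cov t.toNNReal x, y⟫_ℝ) (𝓝[>] 0) (𝓝 ⟪Q x, y⟫_ℝ) := by
  have hc := h.continuous_inner_integrand x y
  have hder := intervalIntegral.integral_hasDerivAt_right (hc.intervalIntegrable 0 0)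
    (hc.stronglyMeasurableAtFilter _ _) hc.continuousAt
  have hlim := hder.tendsto_slope_zero_right
  have h0 := h.semigroup.adjoint.zero_apply
  simp only [Real.toNNReal_zero, h0] at hlim
  refine hlim.congr' ?_
  filter_upwards [self_mem_nhdsWithin] with t ht
  have ht0 : 0 < t := ht
  rw [inner_covCLM, Real.coe_toNNReal _ ht0.le, zero_add, intervalIntegral.integral_same, sub_zero,
    intervalIntegral.integral_of_le ht0.le, smul_eq_mul]

lemma inner_symm (h : IsTraceClassPair S Q) (hs : h.IsSymm) (r : ℝ≥0) (x y : H) :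
    ⟪Q ((S r).adjoint x), y⟫_ℝ = ⟪Q x, (S r).adjoint y⟫_ℝ := by
  refine tendsto_nhds_unique (h.tendsto_inv_mul_inner_cov ((S r).adjoint x) y) ?_
  simp_rw [h.inner_cov_symm hs]
  exact h.tendsto_inv_mul_inner_cov x ((S r).adjoint y)

/-- If Q x = 0 then Q S*(s) x = S(s) Q x = 0 for all s, so the integral Q_∞ x vanishes. -/
lemma injective (h : IsTraceClassPair S Q) (hs : h.IsSymm)
    (hinj : Function.Injective h.covInf) : Function.Injective Q := by
  rw [injective_iff_map_eq_zero]
  intro x hx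
  refine (injective_iff_map_eq_zero _).1 hinj x ?_
  refine ext_inner_right ℝ fun y => ?_
  rw [inner_covCLM, inner_zero_left]
  simp [h.inner_symm hs, hx]

/-- Convexity: with u = S*(t)² w, symmetry makes the difference of the two sides equal to ⟪Q_∞(w -
u), w - u⟫ ≥ 0. -/
lemma inner_cov_adjoint_le (h : IsTraceClassPair S Q) (hs : h.IsSymm) (t : ℝ≥0) (w : H) :
    ⟪h.cov t ((S t).adjoint w), (S t).adjoint w⟫_ℝ ≤ ⟪h.cov t w, w⟫_ℝ := by
  have h1 := h.inner_covInf_eq_add t w w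
  have h2 := h.inner_covInf_eq_add t ((S t).adjoint w) ((S t).adjoint w)
  set u := (S t).adjoint ((S t).adjoint w)
  have h3 : ⟪h.covInf ((S t).adjoint w), (S t).adjoint w⟫_ℝ = ⟪h.covInf w, u⟫_ℝ := hs _ _ _
  have h4 : 0 ≤ ⟪h.covInf (w - u), w - u⟫_ℝ := (h.isPositive_covCLM _).inner_nonneg_left _
  have h5 : ⟪h.covInf u, w⟫_ℝ = ⟪h.covInf w, u⟫_ℝ := by
    rw [(h.isPositive_covCLM _).inner_left_eq_inner_right, real_inner_comm]
  rw [map_sub, inner_sub_left, inner_sub_right, inner_sub_right, h5] at h4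
  linarith

lemma inner_cov_adjoint_nat_mul_le (h : IsTraceClassPair S Q) (hs : h.IsSymm) (t : ℝ≥0) (n : ℕ)
    (x : H) : ⟪h.cov t ((S (n * t)).adjoint x), (S (n * t)).adjoint x⟫_ℝ ≤ ⟪h.cov t x, x⟫_ℝ := by
  have hT := h.semigroup.adjoint
  induction n with
  | zero =>
    have := hT.zero_apply x
    simp [this]
  | succ n ih =>
    have := hT.add_apply t (n * t) x
    rw [Nat.cast_succ, add_mul, one_mul, add_comm _ t, this]
    exact (h.inner_cov_adjoint_le hs t _).trans ih

/-- The adjoint semigroup is contractive with respect to the form of `Q`. -/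
theorem inner_adjoint_le (h : IsTraceClassPair S Q) (hs : h.IsSymm) (r : ℝ≥0) (x : H) :
    ⟪Q ((S r).adjoint x), (S r).adjoint x⟫_ℝ ≤ ⟪Q x, x⟫_ℝ := by
  rcases eq_or_ne r 0 with rfl | hr
  · have := h.semigroup.adjoint.zero_apply x
    rw [this]
  have hr0 : (0 : ℝ) < r := by exact_mod_cast pos_iff_ne_zero.2 hr
  -- Time r is reached in n + 1 steps of length r/(n + 1); the form of Q_t for that step length
  -- decreases at each one. Dividing by the step length and letting n → ∞ gives Q.
  let η : ℕ → ℝ := fun n => r / (n + 1)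
  have hη0 : ∀ n, 0 < η n := fun n => by positivity
  have hη : Tendsto η atTop (𝓝[>] 0) :=
    tendsto_nhdsWithin_iff.2 ⟨tendsto_const_div_atTop_nhds_zero_nat (r : ℝ) |>.comp
      (tendsto_add_atTop_nat 1) |>.congr fun n => by simp [η], Eventually.of_forall hη0⟩
  refine le_of_tendsto_of_tendsto' ((h.tendsto_inv_mul_inner_cov _ _).comp hη)
    ((h.tendsto_inv_mul_inner_cov x x).comp hη) fun n => ?_
  have h1 : r = (n + 1 : ℕ) * (η n).toNNReal := by
    rw [← NNReal.coe_inj, NNReal.coe_mul, Real.coe_toNNReal _ (hη0 n).le]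
    simp only [η]
    push_cast
    field_simp
  have h2 := h.inner_cov_adjoint_nat_mul_le hs (η n).toNNReal (n + 1) x
  rw [← h1] at h2
  exact mul_le_mul_of_nonneg_left h2 (inv_nonneg.2 (hη0 n).le)

lemma inner_cov_le (h : IsTraceClassPair S Q) (hs : h.IsSymm) (t : ℝ≥0) (x : H) :
    ⟪h.cov t x, x⟫_ℝ ≤ t * ⟪Q x, x⟫_ℝ := by
  rw [inner_covCLM]
  have := setIntegral_mono_on (h.integrableOn_inner (I := Ioc 0 (t : ℝ)) Ioc_subset_Ioi_self x x)
    (integrableOn_const (C := ⟪Q x, x⟫_ℝ) (by simp)) measurableSet_Ioc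
    fun s _ => h.inner_adjoint_le hs s.toNNReal x
  simpa using this

/-- By contractivity the integrand defining Q_t is nonincreasing, hence at least its value at the
endpoint t. -/
lemma le_inner_covInf (h : IsTraceClassPair S Q) (hs : h.IsSymm) (t : ℝ≥0) (x : H) :
    t * ⟪Q ((S t).adjoint x), (S t).adjoint x⟫_ℝ ≤ ⟪h.covInf x, x⟫_ℝ := by
  have h1 : t * ⟪Q ((S t).adjoint x), (S t).adjoint x⟫_ℝ ≤ ⟪h.cov t x, x⟫_ℝ := by
    rw [inner_covCLM]
    have := setIntegral_mono_on
      (integrableOn_const (C := ⟪Q ((S t).adjoint x), (S t).adjoint x⟫_ℝ) (by simp))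
      (h.integrableOn_inner (I := Ioc 0 (t : ℝ)) Ioc_subset_Ioi_self x x) measurableSet_Ioc
      fun s hs' => ?_
    · simpa using this
    · have h2 : s.toNNReal ≤ t := Real.toNNReal_le_iff_le_coe.2 hs'.2
      have h3 := h.semigroup.adjoint.add_apply (t - s.toNNReal) s.toNNReal x
      simp only [tsub_add_cancel_of_le h2] at h3
      rw [h3]
      exact h.inner_adjoint_le hs _ _
  have h2 := h.inner_covInf_eq_add t x x
  have h3 : 0 ≤ ⟪h.covInf ((S t).adjoint x), (S t).adjoint x⟫_ℝ :=
    (h.isPositive_covCLM _).inner_nonneg_left _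
  linarith

lemma inner_covInf_adjoint_le (h : IsTraceClassPair S Q) (t : ℝ≥0) (x : H) :
    ⟪h.covInf ((S t).adjoint x), (S t).adjoint x⟫_ℝ ≤ ⟪h.covInf x, x⟫_ℝ := by
  have h2 := h.inner_covInf_eq_add t x x
  have h3 : 0 ≤ ⟪h.cov t x, x⟫_ℝ := (h.isPositive_covCLM _).inner_nonneg_left _
  linarith

/-- Factorization between the forms of two positive operators. -/
lemma exists_factor_posSqrt {A B L : H →L[ℝ] H} (hA : A.IsPositive) (hB : B.IsPositive)
    (hinj : Function.Injective A) {c : ℝ} (hc : 0 ≤ c)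
    (hle : ∀ x, ⟪B (L x), L x⟫_ℝ ≤ c * ⟪A x, x⟫_ℝ) :
    ∃ V : H →L[ℝ] H, (∀ x, V (posSqrt A x) = posSqrt B (L x)) ∧ ‖V‖ ≤ √c := by
  refine exists_factor (posSqrt A : H →ₗ[ℝ] H) (posSqrt B ∘L L : H →L[ℝ] H).toLinearMap
    (denseRange_posSqrt hA hinj) (Real.sqrt_nonneg c) fun x => ?_
  refine le_of_sq_le_sq ?_ (by positivity)
  rw [mul_pow, Real.sq_sqrt hc]
  change ‖posSqrt B (L x)‖ ^ 2 ≤ c * ‖posSqrt A x‖ ^ 2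
  rw [norm_posSqrt_sq hA, norm_posSqrt_sq hB]
  exact hle x

/-- The semigroup `S_Q` on the form of `Q`. -/
lemma exists_formSemigroup (h : IsTraceClassPair S Q) (hs : h.IsSymm)
    (hinj : Function.Injective h.covInf) :
    ∃ A : ℝ≥0 → H →L[ℝ] H, (∀ t x, A t (posSqrt Q x) = posSqrt Q ((S t).adjoint x)) ∧
      (∀ t, ‖A t‖ ≤ 1) ∧ ∀ t, posSqrt Q ∘L A t = S t ∘L posSqrt Q := by
  have hQi := h.injective hs hinj
  have hd := denseRange_posSqrt h.pos hQi
  choose A hA hA1 using fun t => exists_factor_posSqrt (L := (S t).adjoint) h.pos h.pos hQi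
    zero_le_one (fun x => by rw [one_mul]; exact h.inner_adjoint_le hs t x)
  simp only [Real.sqrt_one] at hA1
  refine ⟨A, hA, hA1, fun t => ext_of_denseRange hd fun x => ?_⟩
  have hGG : ∀ y, posSqrt Q (posSqrt Q y) = Q y := fun y =>
    DFunLike.congr_fun (posSqrt_spec h.pos).2 y
  rw [ContinuousLinearMap.comp_apply, ContinuousLinearMap.comp_apply, hA, hGG, hGG]
  -- Both sides agree on the range of Q^{1/2} because Q S*(t) = S(t) Q.
  refine ext_inner_right ℝ fun y => ?_
  rw [h.inner_symm hs, ContinuousLinearMap.adjoint_inner_right]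

/-- The semigroup `S_0` on the form of `Q_∞`. -/
lemma exists_formSemigroupInf (h : IsTraceClassPair S Q) (hs : h.IsSymm)
    (hinj : Function.Injective h.covInf) :
    ∃ B : ℝ≥0 → H →L[ℝ] H,
      (∀ t x, B t (posSqrt h.covInf x) = posSqrt h.covInf ((S t).adjoint x)) ∧
      (∀ t, ‖B t‖ ≤ 1) ∧ ∀ t, (B t).IsSymmetric := by
  have hP : h.covInf.IsPositive := h.isPositive_covCLM _
  choose B hB hB1 using fun t => exists_factor_posSqrt (L := (S t).adjoint) hP hP hinj
    zero_le_one (fun x => by rw [one_mul]; exact h.inner_covInf_adjoint_le t x)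
  simp only [Real.sqrt_one] at hB1
  refine ⟨B, hB, hB1, fun t => isSymmetric_of_denseRange (denseRange_posSqrt hP hinj)
    fun x y => ?_⟩
  rw [hB, hB, inner_posSqrt hP, inner_posSqrt hP]
  exact hs t x y

/-- The smoothing operators between the two forms. -/
lemma exists_smoothing (h : IsTraceClassPair S Q) (hs : h.IsSymm)
    (hinj : Function.Injective h.covInf) {t : ℝ≥0} (ht : 0 < t) :
    ∃ V : H →L[ℝ] H, ∀ x, V (posSqrt h.covInf x) = posSqrt Q ((S t).adjoint x) := by
  have hP : h.covInf.IsPositive := h.isPositive_covCLM _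
  have ht' : (0 : ℝ) < t := ht
  obtain ⟨V, hV, -⟩ := exists_factor_posSqrt (L := (S t).adjoint) hP h.pos hinj
    (c := (t : ℝ)⁻¹) (by positivity) fun x => by
      have := h.le_inner_covInf hs t x
      rw [inv_mul_eq_div, le_div_iff₀ ht']
      linarith
  exact ⟨V, hV⟩

variable {A B : ℝ≥0 → H →L[ℝ] H}

/-- On the range of Q_∞^{1/2} the squared norms are tails of the integral for Q_∞; contractivity and
density give the rest. -/
lemma tendsto_pow_formSemigroupInf (h : IsTraceClassPair S Q)
    (hinj : Function.Injective h.covInf)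
    (hB : ∀ t x, B t (posSqrt h.covInf x) = posSqrt h.covInf ((S t).adjoint x))
    (hB1 : ∀ t, ‖B t‖ ≤ 1) {t : ℝ≥0} (ht : 0 < t) (y : H) :
    Tendsto (fun n : ℕ => (B t ^ n) y) atTop (𝓝 0) := by
  have hP : h.covInf.IsPositive := h.isPositive_covCLM _
  have hd := denseRange_posSqrt hP hinj
  have hpow : ∀ (n : ℕ) x, (B t ^ n) (posSqrt h.covInf x) =
      posSqrt h.covInf ((S (n * t)).adjoint x) := by
    intro n
    induction n with
    | zero =>
      intro x
      have := h.semigroup.adjoint.zero_apply x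
      simp [this]
    | succ n ih =>
      intro x
      have := h.semigroup.adjoint.add_apply (n * t) t x
      rw [pow_succ, mul_apply_eq_comp, hB, ih, ← this, Nat.cast_succ, add_mul, one_mul]
  have hn1 : ∀ n : ℕ, ‖B t ^ n‖ ≤ 1 := fun n => by
    rcases n.eq_zero_or_pos with rfl | hn
    · exact ContinuousLinearMap.norm_id_le
    · exact (norm_pow_le' _ hn).trans (pow_le_one₀ (norm_nonneg _) (hB1 t))
  rw [Metric.tendsto_nhds]
  intro ε hε
  obtain ⟨x, hx⟩ := Metric.denseRange_iff.1 hd y (ε / 2) (half_pos hε)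
  have h1 := (h.tendsto_inner_covInf_adjoint ht x).sqrt
  rw [Real.sqrt_zero] at h1
  filter_upwards [h1.eventually (gt_mem_nhds (half_pos hε))] with n hn
  rw [← norm_posSqrt_sq hP, Real.sqrt_sq (norm_nonneg _), ← hpow] at hn
  rw [dist_zero_right]
  rw [dist_eq_norm] at hx
  calc ‖(B t ^ n) y‖ = ‖(B t ^ n) (y - posSqrt h.covInf x) + (B t ^ n) (posSqrt h.covInf x)‖ := by
        rw [← map_add, sub_add_cancel]
    _ ≤ ‖(B t ^ n) (y - posSqrt h.covInf x)‖ + ‖(B t ^ n) (posSqrt h.covInf x)‖ := norm_add_le _ _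
    _ < ε := by
        have := ((B t ^ n).le_opNorm (y - posSqrt h.covInf x)).trans
          (mul_le_mul_of_nonneg_right (hn1 n) (norm_nonneg _))
        linarith

/-- If `S_0` is compact, then `S_Q` is compact and exponentially stable. -/
theorem compact_stable_of_compact (h : IsTraceClassPair S Q) (hs : h.IsSymm)
    (hinj : Function.Injective h.covInf)
    (hA : ∀ t x, A t (posSqrt Q x) = posSqrt Q ((S t).adjoint x)) (hA1 : ∀ t, ‖A t‖ ≤ 1)
    (hB : ∀ t x, B t (posSqrt h.covInf x) = posSqrt h.covInf ((S t).adjoint x))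
    (hB1 : ∀ t, ‖B t‖ ≤ 1) (hBs : ∀ t, (B t).IsSymmetric) (hc : IsCompactSemigroup B) :
    IsCompactSemigroup A ∧ IsExponentiallyStable A := by
  have hP : h.covInf.IsPositive := h.isPositive_covCLM _
  have hQi := h.injective hs hinj
  have hd := denseRange_posSqrt h.pos hQi
  have hdP := denseRange_posSqrt hP hinj
  have hadd := h.semigroup.adjoint.add_apply
  have hBsg : IsC0Semigroup B := isC0Semigroup_of_intertwine hdP h.semigroup.adjoint hB hB1
  have hAsg : IsC0Semigroup A := isC0Semigroup_of_intertwine hd h.semigroup.adjoint hA hA1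
  obtain ⟨-, -, -, q, -, hq0, hq1, -, -, hBq⟩ := exists_eigenbasis_lt_one (hc 1 one_pos) (hBs 1)
    (h.tendsto_pow_formSemigroupInf hinj hB hB1 one_pos)
  have hq2 : 0 < 1 - q ^ 2 := by nlinarith
  -- Q_∞ = Q_1 + S(1) Q_∞ S*(1), where Q_1 ≤ Q and the last form is at most q² Q_∞. Hence (1 - q²)
  -- Q_∞ ≤ Q.
  obtain ⟨U, hU, -⟩ := exists_factor_posSqrt (L := ContinuousLinearMap.id ℝ H) h.pos hP hQi
    (c := (1 - q ^ 2)⁻¹) (by positivity) fun x => by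
      have h1 := h.inner_covInf_eq_add 1 x x
      have h2 := h.inner_cov_le hs 1 x
      have h3 : ‖B 1 (posSqrt h.covInf x)‖ ≤ q * ‖posSqrt h.covInf x‖ :=
        ((B 1).le_opNorm _).trans (mul_le_mul_of_nonneg_right hBq (norm_nonneg _))
      have h4 := pow_le_pow_left₀ (norm_nonneg _) h3 2
      rw [hB, mul_pow, norm_posSqrt_sq hP, norm_posSqrt_sq hP] at h4
      rw [NNReal.coe_one, one_mul] at h2
      rw [inv_mul_eq_div, le_div_iff₀ hq2, ContinuousLinearMap.id_apply]
      linarith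
  simp only [ContinuousLinearMap.id_apply] at hU
  -- Pass to the form of Q_∞, evolve there for time t, and return with smoothing time s.
  have hfac : ∀ (s t : ℝ≥0) (V : H →L[ℝ] H),
      (∀ x, V (posSqrt h.covInf x) = posSqrt Q ((S s).adjoint x)) →
      A (s + t) = V ∘L B t ∘L U := fun s t V hV => ext_of_denseRange hd fun x => by
    have := hadd s t x
    rw [hA, ContinuousLinearMap.comp_apply, ContinuousLinearMap.comp_apply, hU, hB, hV, this]
  refine ⟨fun t ht => ?_, ?_⟩
  · have ht2 : 0 < t / 2 := by positivity
    obtain ⟨V, hV⟩ := h.exists_smoothing hs hinj ht2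
    rw [← add_halves t, hfac _ _ V hV]
    exact ((hc _ ht2).comp_clm U).clm_comp V
  · obtain ⟨V, hV⟩ := h.exists_smoothing hs hinj one_pos
    have hBn : ∀ n : ℕ, ‖B n‖ ≤ q ^ n := fun n => by
      induction n with
      | zero => simpa using hB1 0
      | succ n ih =>
        rw [Nat.cast_succ, hBsg.map_add, pow_succ]
        exact (ContinuousLinearMap.opNorm_comp_le _ _).trans
          (mul_le_mul ih hBq (norm_nonneg _) (by positivity))
    set K := max 1 (‖V‖ * ‖U‖)
    have hK : 0 < K := lt_max_of_lt_left one_pos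
    -- The factor q ^ (-2) pays for the unit of time spent on smoothing and for rounding the
    -- remaining time down to an integer.
    refine ⟨K * q ^ (-2 : ℝ), -Real.log q, neg_pos.2 (Real.log_neg hq0 hq1), fun t => ?_⟩
    have hexp : K * q ^ (-2 : ℝ) * Real.exp (- -Real.log q * t) = K * q ^ ((t : ℝ) - 2) := by
      rw [neg_neg, ← Real.rpow_def_of_pos hq0, mul_assoc, ← Real.rpow_add hq0]
      congr 2
      ring
    rw [hexp]
    rcases lt_or_ge t 1 with ht | ht
    · have ht' : (t : ℝ) < 1 := ht
      refine (hA1 t).trans ?_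
      have h1 : (1 : ℝ) ≤ q ^ ((t : ℝ) - 2) :=
        Real.one_le_rpow_of_pos_of_le_one_of_nonpos hq0 hq1.le (by linarith)
      have h2 : 1 ≤ K := le_max_left _ _
      nlinarith
    · obtain ⟨s, rfl⟩ : ∃ s, t = 1 + s := ⟨t - 1, (add_tsub_cancel_of_le ht).symm⟩
      set n := ⌊s⌋₊
      have hns : (n : ℝ≥0) ≤ s := Nat.floor_le zero_le
      have hsn : (s : ℝ) < n + 1 := by
        have := Nat.lt_floor_add_one s
        exact_mod_cast this
      -- The time is split as (1 + n) + (s - n); the fractional part costs only a contraction.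
      have h1 : A (1 + s) = (V ∘L B n ∘L U) ∘L A (s - n) := by
        rw [← hfac 1 n V hV, ← hAsg.map_add, add_assoc, add_tsub_cancel_of_le hns]
      rw [h1]
      have h2 : ‖(V ∘L B n ∘L U) ∘L A (s - n)‖ ≤ (‖V‖ * (q ^ n * ‖U‖)) * 1 := by
        refine (ContinuousLinearMap.opNorm_comp_le _ _).trans
          (mul_le_mul ?_ (hA1 _) (norm_nonneg _) (by positivity))
        refine (ContinuousLinearMap.opNorm_comp_le _ _).trans
          (mul_le_mul_of_nonneg_left ?_ (norm_nonneg _))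
        exact (ContinuousLinearMap.opNorm_comp_le _ _).trans
          (mul_le_mul_of_nonneg_right (hBn n) (norm_nonneg _))
      have h3 : q ^ n ≤ q ^ (((1 + s : ℝ≥0) : ℝ) - 2) := by
        rw [← Real.rpow_natCast]
        refine Real.rpow_le_rpow_of_exponent_ge hq0 hq1.le ?_
        push_cast
        linarith
      refine h2.trans ?_
      calc ‖V‖ * (q ^ n * ‖U‖) * 1 = (‖V‖ * ‖U‖) * q ^ n := by ring
        _ ≤ K * q ^ (((1 + s : ℝ≥0) : ℝ) - 2) :=
          mul_le_mul (le_max_right _ _) h3 (by positivity) hK.le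

/-- If `S_Q` is compact and exponentially stable, then `S_0` is compact. -/
theorem compact_of_compact_stable (h : IsTraceClassPair S Q) (hs : h.IsSymm)
    (hinj : Function.Injective h.covInf)
    (hA : ∀ t x, A t (posSqrt Q x) = posSqrt Q ((S t).adjoint x))
    (hB : ∀ t x, B t (posSqrt h.covInf x) = posSqrt h.covInf ((S t).adjoint x))
    (hc : IsCompactSemigroup A) (he : IsExponentiallyStable A) : IsCompactSemigroup B := by
  have hP : h.covInf.IsPositive := h.isPositive_covCLM _
  have hQi := h.injective hs hinj
  have hdP := denseRange_posSqrt hP hinj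
  have hadd := h.semigroup.adjoint.add_apply
  obtain ⟨M, ω, hω, hM⟩ := he
  have hint : IntegrableOn (fun s : ℝ => Real.exp (-(2 * ω) * s)) (Ioi 0) :=
    integrableOn_exp_mul_Ioi (by linarith) 0
  -- The form of Q_∞ is the integral of ‖S_Q(s) Q^{1/2} x‖², at most M² exp(-2ωs) times the form of
  -- Q.
  obtain ⟨U, hU, -⟩ := exists_factor_posSqrt (L := ContinuousLinearMap.id ℝ H) h.pos hP hQi
    (c := M ^ 2 * ∫ s in Ioi (0 : ℝ), Real.exp (-(2 * ω) * s))
    (mul_nonneg (sq_nonneg _) (integral_nonneg fun _ => (Real.exp_pos _).le)) fun x => by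
      rw [ContinuousLinearMap.id_apply, inner_covCLM, ← integral_const_mul, ← integral_mul_const]
      refine setIntegral_mono_on (h.integrableOn_inner Subset.rfl x x)
        ((hint.const_mul _).mul_const _) measurableSet_Ioi fun s hs0 => ?_
      rw [← norm_posSqrt_sq h.pos, ← norm_posSqrt_sq h.pos, ← hA]
      have h1 : ‖A s.toNNReal (posSqrt Q x)‖ ≤ (M * Real.exp (-ω * s)) * ‖posSqrt Q x‖ := by
        refine ((A s.toNNReal).le_opNorm _).trans
          (mul_le_mul_of_nonneg_right ?_ (norm_nonneg _))
        have := hM s.toNNReal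
        rwa [Real.coe_toNNReal _ (le_of_lt hs0)] at this
      refine (pow_le_pow_left₀ (norm_nonneg _) h1 2).trans_eq ?_
      rw [mul_pow, mul_pow, ← Real.exp_nat_mul]
      congr 3
      push_cast
      ring
  simp only [ContinuousLinearMap.id_apply] at hU
  intro t ht
  have ht2 : 0 < t / 2 := by positivity
  obtain ⟨V, hV⟩ := h.exists_smoothing hs hinj ht2
  -- Half of the time is spent smoothing into the form of Q, the other half on the compact operator
  -- S_Q(t/2).
  have hfac : B t = U ∘L A (t / 2) ∘L V := ext_of_denseRange hdP fun x => by
    have := hadd (t / 2) (t / 2) x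
    simp only [add_halves] at this
    rw [hB, ContinuousLinearMap.comp_apply, ContinuousLinearMap.comp_apply, hV, hA, hU, this]
  rw [hfac]
  exact ((hc _ ht2).comp_clm V).clm_comp U

end IsTraceClassPair

end OrnsteinUhlenbeck

namespace OrnsteinUhlenbeck

/-! ### The transition semigroup on L²(μ) as a second quantization -/

namespace IsTraceClassPair

variable {H : Type*} [NormedAddCommGroup H] [InnerProductSpace ℝ H] [CompleteSpace H]
  [TopologicalSpace.SeparableSpace H] [MeasurableSpace H] [BorelSpace H]
  {S : ℝ≥0 → H →L[ℝ] H} {Q : H →L[ℝ] H}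

lemma isCenteredGaussian_invariantMeasure (h : IsTraceClassPair S Q) :
    IsCenteredGaussian h.covInf (invariantMeasure S Q) := by
  rw [h.coe_covCLM]
  exact h.isCenteredGaussian Subset.rfl

lemma isCenteredGaussian_cov (h : IsTraceClassPair S Q) (t : ℝ≥0) :
    IsCenteredGaussian (h.cov t) (centeredGaussian (covOp S Q (Ioc 0 (t : ℝ)))) := by
  rw [h.coe_covCLM]
  exact h.isCenteredGaussian Ioc_subset_Ioi_self

lemma transition_trigExp (h : IsTraceClassPair S Q) (t : ℝ≥0) (k : H) :
    transition S Q t (trigExp h.covInf k) = trigExp h.covInf ((S t).adjoint k) :=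
  funext fun x => (h.isCenteredGaussian_cov t).integral_trigExp_add (S t)
    (fun y => h.inner_covInf_eq_add t y y) k x

/-- Testing symmetry on E_x and E_y equates exp ⟪Q_∞ S*(t)x, y⟫ and exp ⟪Q_∞ S*(t)y, x⟫; the
exponents must then agree. -/
lemma isSymm_of_isSymmetricTransition (h : IsTraceClassPair S Q)
    (hsym : IsSymmetricTransition S Q) : h.IsSymm := fun t x y => by
  have hP : h.covInf.IsPositive := h.isPositive_covCLM _
  have h1 := hsym t (trigExp h.covInf x) (trigExp h.covInf y) (isBoundedBorel_trigExp _ _)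
    (isBoundedBorel_trigExp _ _)
  rw [h.transition_trigExp, h.transition_trigExp,
    h.isCenteredGaussian_invariantMeasure.integral_trigExp_mul hP,
    h.isCenteredGaussian_invariantMeasure.integral_trigExp_mul hP] at h1
  rw [← Real.exp_injective h1, hP.inner_left_eq_inner_right, real_inner_comm]

/-- The extension of the transition semigroup to `L²(μ)`, together with its action on the
exponential functions. -/
lemma exists_isL2Extension (h : IsTraceClassPair S Q) [IsFiniteMeasure (invariantMeasure S Q)] :
    ∃ R : ℝ≥0 → Lp ℝ 2 (invariantMeasure S Q) →L[ℝ] Lp ℝ 2 (invariantMeasure S Q),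
      IsL2Extension S Q R ∧ ∀ t k, R t (trigExpLp h.covInf (invariantMeasure S Q) k) =
        trigExpLp h.covInf (invariantMeasure S Q) ((S t).adjoint k) := by
  have i1 := h.isCenteredGaussian_invariantMeasure.1
  have i2 := fun t => (h.isCenteredGaussian_cov t).1
  have hmp := fun t : ℝ≥0 => measurePreserving_of_gaussian h.isCenteredGaussian_invariantMeasure
    (h.isCenteredGaussian_cov t) (S t) fun y => h.inner_covInf_eq_add t y y
  have hR : IsL2Extension S Q fun t => mehlerOp (hmp t) := fun t φ hφ f hf =>
    mehlerOp_ae_eq (hmp t) hφ hf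
  refine ⟨_, hR, fun t k => Lp.ext ?_⟩
  refine (hR t _ (isBoundedBorel_trigExp _ _) _ (coeFn_trigExpLp _ _ _)).trans ?_
  rw [h.transition_trigExp]
  exact (coeFn_trigExpLp _ _ _).symm

end IsTraceClassPair

end OrnsteinUhlenbeck

/-! ### The main theorem -/

open OrnsteinUhlenbeck in
theorem theorem4p4 {H : Type*} [NormedAddCommGroup H] [InnerProductSpace ℝ H] [CompleteSpace H]
    [TopologicalSpace.SeparableSpace H] [MeasurableSpace H] [BorelSpace H]
    (S : ℝ≥0 → H →L[ℝ] H) (hS : OrnsteinUhlenbeck.IsC0Semigroup S)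
    (Q : H →L[ℝ] H) (hQ : Q.IsPositive)
    (htr : ∫⁻ s in Ioi (0 : ℝ), OrnsteinUhlenbeck.posTrace
      (S s.toNNReal ∘L Q ∘L (S s.toNNReal).adjoint) < ∞)
    (hinj : Function.Injective (OrnsteinUhlenbeck.covOp S Q (Ioi 0)))
    (hsym : OrnsteinUhlenbeck.IsSymmetricTransition S Q) :
    ∃ (R : ℝ≥0 → Lp ℝ 2 (OrnsteinUhlenbeck.invariantMeasure S Q) →L[ℝ]
          Lp ℝ 2 (OrnsteinUhlenbeck.invariantMeasure S Q))
      (SQ : ℝ≥0 → H →L[ℝ] H),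
      OrnsteinUhlenbeck.IsL2Extension S Q R ∧
      -- `SQ t = Q^{-1/2} S(t) Q^{1/2}`
      Function.Injective (OrnsteinUhlenbeck.posSqrt Q) ∧
      (∀ t, OrnsteinUhlenbeck.posSqrt Q ∘L SQ t = S t ∘L OrnsteinUhlenbeck.posSqrt Q) ∧
      OrnsteinUhlenbeck.IsC0Semigroup SQ ∧
      (OrnsteinUhlenbeck.IsCompactSemigroup R ↔
        OrnsteinUhlenbeck.IsCompactSemigroup SQ ∧
          OrnsteinUhlenbeck.IsExponentiallyStable SQ) := by
  have h : IsTraceClassPair S Q := ⟨hS, hQ, htr⟩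
  have hs := h.isSymm_of_isSymmetricTransition hsym
  replace hinj : Function.Injective h.covInf := by rwa [h.coe_covCLM]
  have hQi := h.injective hs hinj
  have hP : h.covInf.IsPositive := h.isPositive_covCLM _
  have hμ := h.isCenteredGaussian_invariantMeasure
  have := hμ.1
  obtain ⟨R, hR, hRF⟩ := h.exists_isL2Extension
  obtain ⟨A, hA, hA1, hAS⟩ := h.exists_formSemigroup hs hinj
  obtain ⟨B, hB, hB1, hBs⟩ := h.exists_formSemigroupInf hs hinj
  have hF : ∀ k l, ⟪trigExpLp h.covInf (invariantMeasure S Q) k,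
      trigExpLp h.covInf (invariantMeasure S Q) l⟫_ℝ =
        Real.exp ⟪posSqrt h.covInf k, posSqrt h.covInf l⟫_ℝ := fun k l => by
    rw [inner_trigExpLp hP hμ, inner_posSqrt hP]
  refine ⟨R, A, hR, posSqrt_injective hQ hQi, hAS,
    isC0Semigroup_of_intertwine (denseRange_posSqrt hQ hQi) hS.adjoint hA hA1, fun hc => ?_,
    fun hc => ?_⟩
  -- Compactness descends from R_t to S_0(t) on the first chaos, then passes to S_Q.
  · refine h.compact_stable_of_compact hs hinj hA hA1 hB hB1 hBs fun t ht => ?_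
    exact isCompactOperator_of_secondQuantization _ _ _ _ _ (denseRange_posSqrt hP hinj) hF
      (hRF t) (hB t) (hc t ht)
  · intro t ht
    -- S_0(t) is compact by comparison with S_Q(t/2); its eigenvalues are bounded by q < 1, so its
    -- second quantization R_t is compact.
    obtain ⟨ι, b, l, q, hl, hq0, hq1, hlq, hfin, -⟩ := exists_eigenbasis_lt_one
      (h.compact_of_compact_stable hs hinj hA hB hc.1 hc.2 t ht) (hBs t)
      (h.tendsto_pow_formSemigroupInf hinj hB hB1 ht)
    exact isCompactOperator_secondQuantization _ _ _ _ _ (dense_span_trigExpLp _ _) hF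
      (hRF t) (hB t) b l (hBs t) hl hq0.le hq1 hlq hfin
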